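/- Let $G_1$ and $G_2$ be compact (Hausdorff) abelian groups with dual groups $\Gamma_1,\Gamma_2$, and let $G=G_1\times G_2$, whose dual group is identified with $\Gamma_1\times\Gamma_2$ via $(\gamma_1,\gamma_2)\mapsto\gamma_1\otimes\gamma_2$, where $(\gamma_1\otimes\gamma_2)(x,y)=\gamma_1(x)\gamma_2(y)$. Let $\Lambda\subset\Gamma_1\times\Gamma_2$ and let $p:\Gamma_1\times\Gamma_2\to\Gamma_1$ be the projection. If $L^1_\Lambda(G)$ is a rich subspace of $L^1(G)$, then $L^1_{p[\Lambda]}(G_1)$ is a rich subspace of $L^1(G_1)$ when $G_1$ is infinite, and $p[\Lambda]=\Gamma_1$ when $G_1$ is finite. Here, for a compact abelian group $H$ with dual group $\Gamma$ (the continuous homomorphisms from $H$ into the circle group) and normalized Haar measure $m$ on the Borel sets, $L^1(H)$ is the complex space $L^1(H,m)$, and for $\Theta\subset\Gamma$ $$L^1_\Theta(H)=\{f\in L^1(H): \hat f(\gamma)=0 \text{ for all } \gamma\in\Gamma\setminus\Theta\},\qquad \hat f(\gamma)=\int_H\overline{\gamma}\,f\,dm .$$ A Banach space $X$ has the Daugavet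 property if $\|\mathrm{Id}+T\|=1+\|T\|$ for every bounded operator $T:X\to X$ of rank one. A closed subspace $Y$ of $X$ is rich if $X$ has the Daugavet property and the quotient map $\pi:X\to X/Y$ is narrow, i.e., for all $x,y\in X$ with $\|x\|=\|y\|=1$, all $x^*\in X^*$ and all $\varepsilon>0$ there is $z\in X$ with $\|z\|=1$, $\|\pi(y-z)\|+|x^*(y-z)|\le\varepsilon$ and $\|x+z\|\ge 2-\varepsilon$. -/

import Mathlib

open MeasureTheory
open scoped ComplexConjugate

noncomputable section

section Daugavet

variable (𝕜 : Type*) [RCLike 𝕜]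

/-- `X` has the Daugavet property: `‖Id + T‖ = 1 + ‖T‖` for all bounded operators `T : X → X`
of rank one. -/
def DaugavetProperty (X : Type*) [NormedAddCommGroup X] [NormedSpace 𝕜 X] : Prop :=
  ∀ T : X →L[𝕜] X, Module.finrank 𝕜 (LinearMap.range (T : X →ₗ[𝕜] X)) = 1 →
    ‖ContinuousLinearMap.id 𝕜 X + T‖ = 1 + ‖T‖

variable {𝕜} {X E : Type*} [NormedAddCommGroup X] [NormedSpace 𝕜 X]
  [NormedAddCommGroup E] [NormedSpace 𝕜 E]

/-- Narrow operators on a Banach space with the Daugavet property. -/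
def IsNarrow (T : X →L[𝕜] E) : Prop :=
  DaugavetProperty 𝕜 X ∧
    ∀ x y : X, ‖x‖ = 1 → ‖y‖ = 1 → ∀ φ : X →L[𝕜] 𝕜, ∀ ε : ℝ, 0 < ε →
      ∃ z : X, ‖z‖ = 1 ∧ ‖T (y - z)‖ + ‖φ (y - z)‖ ≤ ε ∧ 2 - ε ≤ ‖x + z‖

/-- A closed subspace `Y` of `X` is rich if the quotient map `X → X ⧸ Y` is narrow. -/
def IsRich (Y : Submodule 𝕜 X) [IsClosed (Y : Set X)] : Prop :=
  IsNarrow Y.mkQL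

end Daugavet

section CompactGroup

variable (G : Type*) [CommGroup G] [TopologicalSpace G] [IsTopologicalGroup G] [CompactSpace G]

/-- The normalized Haar measure of a compact group, on its Borel `σ`-algebra. The `σ`-algebra
is written out because on a product of groups the default one is the product `σ`-algebra,
which can be smaller than the Borel `σ`-algebra. -/
def haarProb : @Measure G (borel G) :=
  letI : MeasurableSpace G := borel G
  haveI : BorelSpace G := ⟨rfl⟩
  Measure.haarMeasure ⊤

instance haarProb.isProbabilityMeasure :
    @IsProbabilityMeasure G (borel G) (haarProb G) := by
  let : MeasurableSpace G := borel G
  have : BorelSpace G := ⟨rfl⟩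
  refine ⟨?_⟩
  have h := Measure.haarMeasure_self (K₀ := (⊤ : TopologicalSpace.PositiveCompacts G))
  simpa [haarProb] using h

/-- The complex Banach space `L¹(G)`. -/
abbrev L1 : Type _ := @Lp G ℂ (borel G) _ 1 (haarProb G)

variable {G}

/-- The Fourier coefficient of `f` at the character `γ`, the integral of `conj γ * f`. -/
def fourierCoeffL1 (f : L1 G) (γ : PontryaginDual G) : ℂ :=
  letI : MeasurableSpace G := borel G
  ∫ x, conj (γ x : ℂ) * f x ∂(haarProb G)

/-- The spectrum of `f`: the set of characters with nonzero Fourier coefficient. -/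
def spec (f : L1 G) : Set (PontryaginDual G) :=
  {γ | fourierCoeffL1 f γ ≠ 0}

theorem integrable_conj_mul (f : L1 G) (γ : PontryaginDual G) :
    letI : MeasurableSpace G := borel G
    Integrable (fun x => conj (γ x : ℂ) * f x) (haarProb G) := by
  let : MeasurableSpace G := borel G
  have : BorelSpace G := ⟨rfl⟩
  have hc : Continuous fun x : G => conj (γ x : ℂ) :=
    Complex.continuous_conj.comp (continuous_subtype_val.comp (map_continuous γ))
  refine (L1.integrable_coeFn f).bdd_mul (c := 1) ?_ ?_
  · exact (hc.measurable).aestronglyMeasurable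
  · exact Filter.Eventually.of_forall fun x => by
      rw [RCLike.norm_conj, Circle.norm_coe]

theorem fourierCoeffL1_zero (γ : PontryaginDual G) : fourierCoeffL1 (0 : L1 G) γ = 0 := by
  let : MeasurableSpace G := borel G
  unfold fourierCoeffL1
  refine integral_eq_zero_of_ae ?_
  filter_upwards [Lp.coeFn_zero ℂ 1 (haarProb G)] with x hx
  rw [hx, Pi.zero_apply, mul_zero]

theorem fourierCoeffL1_add (f g : L1 G) (γ : PontryaginDual G) :
    fourierCoeffL1 (f + g) γ = fourierCoeffL1 f γ + fourierCoeffL1 g γ := by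
  let : MeasurableSpace G := borel G
  unfold fourierCoeffL1
  rw [← integral_add (integrable_conj_mul f γ) (integrable_conj_mul g γ)]
  refine integral_congr_ae ?_
  filter_upwards [Lp.coeFn_add f g] with x hx
  rw [hx, Pi.add_apply, mul_add]

theorem fourierCoeffL1_smul (c : ℂ) (f : L1 G) (γ : PontryaginDual G) :
    fourierCoeffL1 (c • f) γ = c * fourierCoeffL1 f γ := by
  let : MeasurableSpace G := borel G
  unfold fourierCoeffL1
  rw [← integral_const_mul]
  refine integral_congr_ae ?_
  filter_upwards [Lp.coeFn_smul c f] with x hx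
  simp only [hx, Pi.smul_apply, smul_eq_mul]
  ring

theorem norm_fourierCoeffL1_le (f : L1 G) (γ : PontryaginDual G) :
    ‖fourierCoeffL1 f γ‖ ≤ ‖f‖ := by
  let : MeasurableSpace G := borel G
  rw [L1.norm_eq_integral_norm]
  refine (norm_integral_le_integral_norm _).trans (le_of_eq ?_)
  refine integral_congr_ae (Filter.Eventually.of_forall fun x => ?_)
  change ‖conj (γ x : ℂ) * f x‖ = ‖f x‖
  rw [norm_mul, RCLike.norm_conj, Circle.norm_coe, one_mul]

theorem continuous_fourierCoeffL1 (γ : PontryaginDual G) :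
    Continuous fun f : L1 G => fourierCoeffL1 f γ :=
  let F : L1 G →ₗ[ℂ] ℂ :=
    { toFun := fun f => fourierCoeffL1 f γ
      map_add' := fun f g => fourierCoeffL1_add f g γ
      map_smul' := fun c f => fourierCoeffL1_smul c f γ }
  (F.mkContinuous 1 fun f => by simpa [F] using norm_fourierCoeffL1_le f γ).continuous

/-- The translation-invariant subspace `L¹_Λ(G)` of all `f` with `spec f ⊆ Λ`. -/
def L1Spec (Λ : Set (PontryaginDual G)) : Submodule ℂ (L1 G) where
  carrier := {f | spec f ⊆ Λ}
  zero_mem' := fun γ hγ => absurd (fourierCoeffL1_zero γ) hγ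
  add_mem' := fun {f g} hf hg γ hγ => by
    by_contra h
    have h1 : fourierCoeffL1 f γ = 0 := not_not.1 fun h' => h (hf h')
    have h2 : fourierCoeffL1 g γ = 0 := not_not.1 fun h' => h (hg h')
    exact hγ (by rw [fourierCoeffL1_add, h1, h2, add_zero])
  smul_mem' := fun c f hf γ hγ => by
    by_contra h
    have h1 : fourierCoeffL1 f γ = 0 := not_not.1 fun h' => h (hf h')
    exact hγ (by rw [fourierCoeffL1_smul, h1, mul_zero])

instance L1Spec.isClosed (Λ : Set (PontryaginDual G)) :
    IsClosed (L1Spec Λ : Set (L1 G)) := by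
  have h : (L1Spec Λ : Set (L1 G)) = ⋂ γ ∈ Λᶜ, {f : L1 G | fourierCoeffL1 f γ = 0} := by
    ext f
    simp only [Set.mem_iInter, Set.mem_compl_iff]
    exact ⟨fun hf γ hγ => not_not.1 fun h' => hγ (hf h'),
      fun hf γ hγ => by_contra fun h' => hγ (hf γ h')⟩
  rw [h]
  exact isClosed_biInter fun γ _ => isClosed_eq (continuous_fourierCoeffL1 γ) continuous_const

end CompactGroup

/-- The identification of `Γ₁ × Γ₂` with the dual group of `G₁ × G₂`: the pair `(γ₁, γ₂)`
corresponds to the character `γ₁ ⊗ γ₂ : (x, y) ↦ γ₁ x * γ₂ y`. -/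
def dualProdEquiv (G₁ G₂ : Type*) [CommGroup G₁] [TopologicalSpace G₁]
    [CommGroup G₂] [TopologicalSpace G₂] :
    PontryaginDual G₁ × PontryaginDual G₂ ≃* PontryaginDual (G₁ × G₂) where
  toFun γ := ContinuousMonoidHom.coprod (γ.1 : G₁ →ₜ* Circle) (γ.2 : G₂ →ₜ* Circle)
  invFun γ := (PontryaginDual.map (ContinuousMonoidHom.inl G₁ G₂) γ,
    PontryaginDual.map (ContinuousMonoidHom.inr G₁ G₂) γ)
  left_inv γ := by
    refine Prod.ext (PontryaginDual.ext fun x => ?_) (PontryaginDual.ext fun y => ?_)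
    · change γ.1 x * γ.2 1 = γ.1 x
      rw [map_one, mul_one]
    · change γ.1 1 * γ.2 y = γ.2 y
      rw [map_one, one_mul]
  right_inv γ := by
    refine PontryaginDual.ext fun x => ?_
    change γ (x.1, 1) * γ (1, x.2) = γ x
    rw [← map_mul]
    simp
  map_mul' γ δ := by
    refine PontryaginDual.ext fun x => ?_
    change (γ.1 x.1 * δ.1 x.1) * (γ.2 x.2 * δ.2 x.2) = (γ.1 x.1 * γ.2 x.2) * (δ.1 x.1 * δ.2 x.2)
    exact mul_mul_mul_comm _ _ _ _

end

/-!
Slicing turns an integrable function on `G₁ × G₂` into an `L¹(G₁)`-valued integrable function on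
`G₂`. Almost every slice of an element of `L¹_Λ` lies in `L¹_{p[Λ]}(G₁)`, because the characters
separate the points of `G₂` and hence span a dense subspace of `C(G₂)`. Let `γ ∉ p[Λ]`. Applying
the richness of `L¹_Λ` to functions that do not depend on the second variable, picking one good
slice and multiplying by `conj γ` (so that the functions in `L¹_{p[Λ]}(G₁)` acquire integral zero),
one sees that, modulo `conj γ • L¹_{p[Λ]}(G₁)`, an indicator function may be replaced by a function
of almost the same norm which is almost concentrated on the same set and almost `ℓ¹`-orthogonal to
any prescribed function: it has a peak there.

A functional on `L¹` is integration against a bounded function, which is nearly constant on the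
pieces of some finite partition. Peaks on these pieces therefore give narrowness of the quotient
map. Conversely there are no peaks on an atom, and every point of a finite group is one. If
`p[Λ] = Γ₁` the quotient is trivial, and peaks exist as soon as Haar measure has no atoms.
-/

section Replacement

variable {𝕜 X E : Type*} [RCLike 𝕜] [NormedAddCommGroup X] [NormedSpace 𝕜 X]
  [NormedAddCommGroup E] [NormedSpace 𝕜 E]

theorem le_norm_smul_add_smul {x z : X} {a b ε : ℝ} (ha : 0 ≤ a) (hb : 0 ≤ b) (hx : ‖x‖ ≤ 1)
    (hz : ‖z‖ ≤ 1) (h : 2 - ε ≤ ‖x + z‖) :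
    a + b - max a b * ε ≤ ‖(a : 𝕜) • x + (b : 𝕜) • z‖ := by
  wlog hab : b ≤ a generalizing x z a b
  · rw [add_comm a, max_comm, add_comm (_ • x)]
    exact this hb ha hz hx (by rwa [add_comm]) (le_of_not_ge hab)
  have hsplit : (a : 𝕜) • (x + z) = ((a : 𝕜) • x + (b : 𝕜) • z) + ((a - b : ℝ) : 𝕜) • z := by
    push_cast; module
  have hnorm := norm_add_le ((a : 𝕜) • x + (b : 𝕜) • z) (((a - b : ℝ) : 𝕜) • z)
  rw [← hsplit, norm_smul, norm_smul, RCLike.norm_of_nonneg ha,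
    RCLike.norm_of_nonneg (sub_nonneg.2 hab)] at hnorm
  rw [max_eq_left hab]
  nlinarith [mul_le_mul_of_nonneg_left h ha, mul_le_mul_of_nonneg_left hz (sub_nonneg.2 hab)]

theorem le_of_forall_pos_le_add_mul {a b K : ℝ} (h : ∀ δ > 0, a ≤ b + K * δ) : a ≤ b := by
  have hlim : Filter.Tendsto (fun δ : ℝ => b + K * δ) (nhdsWithin 0 (Set.Ioi 0)) (nhds b) := by
    have : Continuous fun δ : ℝ => b + K * δ := by fun_prop
    simpa using (this.tendsto 0).mono_left nhdsWithin_le_nhds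
  exact ge_of_tendsto hlim (Filter.eventually_of_mem self_mem_nhdsWithin h)

/-- `y` can be replaced, up to small error for `T` and relative error `ε` for `φ`, by an element of
almost the same norm that is almost `ℓ¹`-orthogonal to any prescribed element. This is the condition
of `IsNarrow` on `y`, without normalization and with separate accuracies for `T` and `φ`. -/
def IsReplaceable (T : X →L[𝕜] E) (φ : X →L[𝕜] 𝕜) (ε : ℝ) (y : X) : Prop :=
  ∀ (x : X) (δ : ℝ), 0 < δ → ∃ z, ‖z‖ ≤ ‖y‖ + δ ∧ ‖T (y - z)‖ ≤ δ ∧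
    ‖φ (y - z)‖ ≤ ε * ‖y‖ + δ ∧ ‖x‖ + ‖y‖ - δ ≤ ‖x + z‖

namespace IsReplaceable

variable {T : X →L[𝕜] E} {φ : X →L[𝕜] 𝕜} {ε : ℝ} {y y₁ y₂ : X}

theorem zero : IsReplaceable T φ ε 0 := fun x δ hδ =>
  ⟨0, by simpa using hδ.le, by simpa using hδ.le, by simpa using hδ.le, by simpa using hδ.le⟩

theorem smul (hy : IsReplaceable T φ ε y) (c : 𝕜) : IsReplaceable T φ ε (c • y) := by
  rcases eq_or_ne c 0 with rfl | hc
  · simpa only [zero_smul] using zero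
  intro x δ hδ
  have hc' : 0 < ‖c‖ := norm_pos_iff.2 hc
  have hδc : ‖c‖ * (δ / ‖c‖) = δ := mul_div_cancel₀ δ hc'.ne'
  obtain ⟨z, hz, hT, hφ, hxz⟩ := hy (c⁻¹ • x) (δ / ‖c‖) (by positivity)
  have hx : ‖c‖ * ‖c⁻¹ • x‖ = ‖x‖ := by rw [← norm_smul, smul_inv_smul₀ hc]
  have hadd : x + c • z = c • (c⁻¹ • x + z) := by rw [smul_add, smul_inv_smul₀ hc]
  refine ⟨c • z, ?_, ?_, ?_, ?_⟩
  · rw [norm_smul, norm_smul]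
    nlinarith
  · rw [← smul_sub, map_smul, norm_smul]
    nlinarith
  · rw [← smul_sub, map_smul, norm_smul, norm_smul]
    nlinarith
  · rw [hadd, norm_smul, norm_smul]
    nlinarith

theorem add (h₁ : IsReplaceable T φ ε y₁) (h₂ : IsReplaceable T φ ε y₂)
    (h : ‖y₁ + y₂‖ = ‖y₁‖ + ‖y₂‖) : IsReplaceable T φ ε (y₁ + y₂) := by
  intro x δ hδ
  obtain ⟨z₁, hz₁, hT₁, hφ₁, hx₁⟩ := h₁ x (δ / 2) (half_pos hδ)
  obtain ⟨z₂, hz₂, hT₂, hφ₂, hx₂⟩ := h₂ (x + z₁) (δ / 2) (half_pos hδ)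
  refine ⟨z₁ + z₂, ?_, ?_, ?_, ?_⟩
  · linarith [norm_add_le z₁ z₂]
  · rw [add_sub_add_comm, map_add]
    linarith [norm_add_le (T (y₁ - z₁)) (T (y₂ - z₂))]
  · rw [add_sub_add_comm, map_add, h, mul_add]
    linarith [norm_add_le (φ (y₁ - z₁)) (φ (y₂ - z₂))]
  · rw [← add_assoc]
    linarith

theorem isClosed_setOf (hε : 0 ≤ ε) : IsClosed {y | IsReplaceable T φ ε y} := by
  refine isClosed_of_closure_subset fun y hy x δ hδ => ?_
  set K : ℝ := 1 + ‖T‖ + ‖φ‖ + ε with hK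
  set r : ℝ := δ / (2 * K) with hr
  have hr0 : 0 < r := by positivity
  have hKr : r + ‖T‖ * r + ‖φ‖ * r + ε * r = δ / 2 := by rw [hr, hK]; field_simp
  have hTr : 0 ≤ ‖T‖ * r := by positivity
  have hφr : 0 ≤ ‖φ‖ * r := by positivity
  have hεr : 0 ≤ ε * r := by positivity
  obtain ⟨y', hy', hd⟩ := Metric.mem_closure_iff.1 hy r hr0
  rw [dist_eq_norm] at hd
  obtain ⟨z, hz, hT, hφ, hxz⟩ := hy' x (δ / 2) (half_pos hδ)
  have hy'_le : ‖y'‖ ≤ ‖y‖ + r := by linarith [norm_le_norm_add_norm_sub y y']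
  have hy_le : ‖y‖ ≤ ‖y'‖ + r := by linarith [norm_le_norm_add_norm_sub' y y']
  have hsplit : y - z = (y - y') + (y' - z) := (sub_add_sub_cancel y y' z).symm
  refine ⟨z, by linarith, ?_, ?_, by linarith⟩
  · rw [hsplit, map_add]
    have : ‖T (y - y')‖ ≤ ‖T‖ * r := (T.le_opNorm _).trans (by gcongr)
    linarith [norm_add_le (T (y - y')) (T (y' - z))]
  · rw [hsplit, map_add]
    have : ‖φ (y - y')‖ ≤ ‖φ‖ * r := (φ.le_opNorm _).trans (by gcongr)
    have : ε * ‖y'‖ ≤ ε * ‖y‖ + ε * r := by rw [← mul_add]; gcongr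
    linarith [norm_add_le (φ (y - y')) (φ (y' - z))]

theorem map_linearIsometryEquiv {V : Type*} [NormedAddCommGroup V] [NormedSpace 𝕜 V]
    {T : V →L[𝕜] E} {φ : V →L[𝕜] 𝕜} (e : X ≃ₗᵢ[𝕜] V)
    (h : IsReplaceable (T ∘L e) (φ ∘L e) ε y) : IsReplaceable T φ ε (e y) := by
  intro x δ hδ
  obtain ⟨z, hz, hT, hφ, hxz⟩ := h (e.symm x) δ hδ
  refine ⟨e z, by simpa using hz, by simpa using hT, by simpa using hφ, ?_⟩
  have hadd : x + e z = e (e.symm x + z) := by rw [map_add, e.apply_symm_apply]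
  rwa [hadd, e.norm_map, e.norm_map, ← e.symm.norm_map x]

end IsReplaceable

theorem IsNarrow.isReplaceable {T : X →L[𝕜] E} (hT : IsNarrow T) (φ : X →L[𝕜] 𝕜) (y : X) :
    IsReplaceable T φ 0 y := by
  intro x δ hδ
  rcases eq_or_ne x 0 with rfl | hx
  · exact ⟨y, by simpa using hδ.le, by simpa using hδ.le, by simpa using hδ.le,
      by simpa using hδ.le⟩
  rcases eq_or_ne y 0 with rfl | hy
  · exact IsReplaceable.zero x δ hδ
  have hunit {v : X} (hv : v ≠ 0) : ‖(‖v‖ : 𝕜)⁻¹ • v‖ = 1 := norm_smul_inv_norm hv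
  have hscale {v : X} (hv : v ≠ 0) : (‖v‖ : 𝕜) • (‖v‖ : 𝕜)⁻¹ • v = v :=
    smul_inv_smul₀ (by simpa using hv) v
  have hpos : 0 < max ‖x‖ ‖y‖ := lt_max_of_lt_left (norm_pos_iff.2 hx)
  obtain ⟨z, hz, hTφ, hxz⟩ := hT.2 _ _ (hunit hx) (hunit hy) φ _ (div_pos hδ hpos)
  have hsub : y - (‖y‖ : 𝕜) • z = (‖y‖ : 𝕜) • ((‖y‖ : 𝕜)⁻¹ • y - z) := by
    rw [smul_sub, hscale hy]
  have hδy {r : ℝ} (hr : r ≤ δ / max ‖x‖ ‖y‖) : ‖y‖ * r ≤ δ := by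
    refine (mul_le_mul_of_nonneg_left hr (norm_nonneg y)).trans ?_
    rw [mul_div_left_comm]
    exact mul_le_of_le_one_right hδ.le (div_le_one_of_le₀ (le_max_right _ _) hpos.le)
  refine ⟨(‖y‖ : 𝕜) • z, ?_, ?_, ?_, ?_⟩
  · rw [norm_smul, RCLike.norm_ofReal, abs_norm, hz, mul_one]
    linarith
  · rw [hsub, map_smul, norm_smul, RCLike.norm_ofReal, abs_norm]
    exact hδy (by linarith [norm_nonneg (φ ((‖y‖ : 𝕜)⁻¹ • y - z))])
  · rw [hsub, map_smul, norm_smul, RCLike.norm_ofReal, abs_norm, zero_mul, zero_add]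
    exact hδy (by linarith [norm_nonneg (T ((‖y‖ : 𝕜)⁻¹ • y - z))])
  · have := le_norm_smul_add_smul (𝕜 := 𝕜) (norm_nonneg x) (norm_nonneg y) (hunit hx).le hz.le hxz
    rwa [mul_div_cancel₀ _ hpos.ne', hscale hx] at this

theorem norm_id_add_smulRight_of_isReplaceable {T : X →L[𝕜] E} (g : X →L[𝕜] 𝕜) (v : X)
    (h : ∀ ε > 0, ∀ y, IsReplaceable T g ε y) (y : X) :
    ‖y‖ + ‖g.smulRight v y‖ ≤ ‖ContinuousLinearMap.id 𝕜 X + g.smulRight v‖ * ‖y‖ := by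
  set R := ContinuousLinearMap.id 𝕜 X + g.smulRight v with hR
  refine le_of_forall_pos_le_add_mul (K := 1 + ‖R‖ + (‖y‖ + 1) * ‖v‖) fun δ hδ => ?_
  obtain ⟨z, hz, -, hg, hxz⟩ := h δ hδ y (g y • v) δ hδ
  have hsplit : g y • v + z = R z + g (y - z) • v := by
    simp only [hR, map_sub, sub_smul, add_apply, ContinuousLinearMap.id_apply,
      ContinuousLinearMap.smulRight_apply]
    abel
  calc ‖y‖ + ‖g.smulRight v y‖ ≤ ‖R z + g (y - z) • v‖ + δ := by
        rw [← hsplit, ContinuousLinearMap.smulRight_apply]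
        linarith
    _ ≤ ‖R z‖ + ‖g (y - z)‖ * ‖v‖ + δ := by
        rw [← norm_smul]
        gcongr
        exact norm_add_le _ _
    _ ≤ ‖R‖ * (‖y‖ + δ) + (δ * ‖y‖ + δ) * ‖v‖ + δ := by
        gcongr
        exact (R.le_opNorm z).trans (by gcongr)
    _ = ‖R‖ * ‖y‖ + (1 + ‖R‖ + (‖y‖ + 1) * ‖v‖) * δ := by ring

theorem exists_eq_smulRight_of_finrank_range_eq_one {R : X →L[𝕜] X}
    (hR : Module.finrank 𝕜 (LinearMap.range (R : X →ₗ[𝕜] X)) = 1) :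
    ∃ (g : X →L[𝕜] 𝕜) (v : X), R = g.smulRight v := by
  obtain ⟨⟨v, hv⟩, hv0, hspan⟩ := finrank_eq_one_iff'.1 hR
  obtain ⟨g, hg⟩ := SeparatingDual.exists_eq_one (R := 𝕜) (x := v) fun h0 => hv0 (Subtype.ext h0)
  refine ⟨g ∘L R, v, ContinuousLinearMap.ext fun u => ?_⟩
  obtain ⟨c, hc⟩ := hspan ⟨R u, u, rfl⟩
  have hc : c • v = R u := congrArg Subtype.val hc
  rw [ContinuousLinearMap.smulRight_apply, ContinuousLinearMap.comp_apply, ← hc, map_smul, hg,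
    smul_eq_mul, mul_one]

theorem daugavetProperty_of_isReplaceable {T : X →L[𝕜] E}
    (h : ∀ φ, ∀ ε > 0, ∀ y, IsReplaceable T φ ε y) : DaugavetProperty 𝕜 X := by
  intro R hR
  refine le_antisymm ((norm_add_le _ _).trans
    (add_le_add_left ContinuousLinearMap.norm_id_le _)) ?_
  have hbound : ∀ y, ‖y‖ + ‖R y‖ ≤ ‖ContinuousLinearMap.id 𝕜 X + R‖ * ‖y‖ := by
    obtain ⟨g, v, rfl⟩ := exists_eq_smulRight_of_finrank_range_eq_one hR
    exact norm_id_add_smulRight_of_isReplaceable g v (h g)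
  obtain ⟨⟨_, y, rfl⟩, hy, -⟩ := finrank_eq_one_iff'.1 hR
  have hy : 0 < ‖y‖ := norm_pos_iff.2 fun h0 => hy (by simp [h0])
  have hone : 1 ≤ ‖ContinuousLinearMap.id 𝕜 X + R‖ :=
    le_of_mul_le_mul_right (by linarith [hbound y, norm_nonneg (R y)]) hy
  have hle : ‖R‖ ≤ ‖ContinuousLinearMap.id 𝕜 X + R‖ - 1 :=
    R.opNorm_le_bound (sub_nonneg.2 hone) fun u => by linarith [hbound u]
  linarith

theorem isNarrow_of_isReplaceable {T : X →L[𝕜] E}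
    (h : ∀ φ, ∀ ε > 0, ∀ y, IsReplaceable T φ ε y) : IsNarrow T := by
  refine ⟨daugavetProperty_of_isReplaceable h, fun x y hx hy φ ε hε => ?_⟩
  set K : ℝ := 4 + ‖T‖ + ‖φ‖
  set δ : ℝ := min (ε / K) (1 / 2)
  have hδ0 : 0 < δ := by positivity
  have hδK : K * δ ≤ ε := (mul_le_mul_of_nonneg_left (min_le_left _ _) (by positivity)).trans_eq
    (mul_div_cancel₀ _ (by positivity))
  have hδ2 : δ ≤ 1 / 2 := min_le_right _ _
  obtain ⟨z, hz, hTz, hφz, hxz⟩ := h φ δ hδ0 y x δ hδ0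
  rw [hx, hy] at hxz
  rw [hy] at hz hφz
  have hz0 : 1 - δ ≤ ‖z‖ := by linarith [norm_add_le x z]
  have hz' : z ≠ 0 := norm_pos_iff.1 (by linarith)
  set w : X := (‖z‖ : 𝕜)⁻¹ • z with hw
  have hzw : ‖z - w‖ ≤ δ := by
    have : z - w = ((‖z‖ - 1 : ℝ) : 𝕜) • w := by
      rw [RCLike.ofReal_sub, sub_smul, hw, smul_inv_smul₀ (by simpa using hz')]
      simp
    rw [this, norm_smul, norm_smul_inv_norm hz', mul_one, RCLike.norm_ofReal, abs_le]
    constructor <;> linarith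
  have hsplit : y - w = (y - z) + (z - w) := (sub_add_sub_cancel y z w).symm
  have hT : ‖T (z - w)‖ ≤ ‖T‖ * δ := (T.le_opNorm _).trans (by gcongr)
  have hφ : ‖φ (z - w)‖ ≤ ‖φ‖ * δ := (φ.le_opNorm _).trans (by gcongr)
  refine ⟨w, norm_smul_inv_norm hz', ?_, ?_⟩
  · rw [hsplit, map_add, map_add]
    linarith [norm_add_le (T (y - z)) (T (z - w)), norm_add_le (φ (y - z)) (φ (z - w))]
  · have := norm_add_le (x + w) (z - w)
    rw [show x + w + (z - w) = x + z by abel] at this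
    nlinarith [norm_nonneg T, norm_nonneg φ]

end Replacement

section L1Dual

open Filter
open scoped ENNReal

variable {α 𝕜 : Type*} {_ : MeasurableSpace α} {μ : Measure α} [RCLike 𝕜]

theorem ae_norm_le_of_forall_norm_integral_mul_le {g : α → 𝕜} {C : ℝ} (hC : 0 ≤ C)
    (hg : Measurable g) (hgi : Integrable g μ)
    (h : ∀ f : α → 𝕜, Measurable f → (∀ x, ‖f x‖ ≤ 1) → ‖∫ x, g x * f x ∂μ‖ ≤ C * ∫ x, ‖f x‖ ∂μ) :
    ∀ᵐ x ∂μ, ‖g x‖ ≤ C := by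
  set A : Set α := {x | C < ‖g x‖}
  have hAm : MeasurableSet A := measurableSet_lt measurable_const hg.norm
  let f : α → 𝕜 := A.indicator fun x => conj (g x) / ‖g x‖
  have hfm : Measurable f :=
    ((RCLike.continuous_conj.measurable.comp hg).div
      (RCLike.measurable_ofReal.comp hg.norm)).indicator hAm
  have hpos : ∀ x ∈ A, ‖g x‖ ≠ 0 := fun x hx => (hC.trans_lt hx).ne'
  have hfn : ∀ x, ‖f x‖ = A.indicator (fun _ => 1) x := fun x => by
    by_cases hx : x ∈ A
    · simp [f, hx, hpos x hx]
    · simp [f, hx]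
  have hgf : ∀ x, g x * f x = ((A.indicator (fun x => ‖g x‖) x : ℝ) : 𝕜) := fun x => by
    by_cases hx : x ∈ A
    · have : (‖g x‖ : 𝕜) ≠ 0 := by exact_mod_cast hpos x hx
      simp only [f, hx, Set.indicator_of_mem]
      rw [mul_div_assoc', RCLike.mul_conj, sq, mul_div_cancel_right₀ _ this]
    · simp [f, hx]
  have hle := h f hfm fun x => (hfn x).trans_le (Set.indicator_le_self' (fun _ _ => zero_le_one) x)
  simp only [hgf, hfn] at hle
  rw [integral_ofReal, RCLike.norm_ofReal, integral_indicator hAm, integral_indicator_const _ hAm,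
    smul_eq_mul, mul_one, mul_comm] at hle
  rw [ae_iff]
  by_contra hne
  simp only [not_le] at hne
  exact ((le_abs_self _).trans hle).not_gt (setIntegral_gt_gt hC hgi.norm.integrableOn hne)

variable [IsFiniteMeasure μ]

theorem exists_memLp_two_forall_apply_eq_integral_mul (φ : Lp 𝕜 1 μ →L[𝕜] 𝕜) :
    ∃ g : α → 𝕜, Measurable g ∧ MemLp g 2 μ ∧ ∀ (f : α → 𝕜) (_ : MemLp f 2 μ) (hf1 : MemLp f 1 μ),
      φ (hf1.toLp f) = ∫ x, g x * f x ∂μ := by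
  let ι : Lp 𝕜 2 μ →L[𝕜] Lp 𝕜 1 μ :=
    (ContinuousLinearMap.mul 𝕜 𝕜).holderL μ 2 2 1 (Lp.const 2 μ 1)
  have hι : ∀ f, ι f =ᵐ[μ] f := fun f => by
    filter_upwards [(ContinuousLinearMap.mul 𝕜 𝕜).coeFn_holder (r := 1) (Lp.const 2 μ 1) f,
      Lp.coeFn_const (p := 2) (μ := μ) (1 : 𝕜)] with x hx hx'
    exact hx.trans (by rw [hx', Function.const_apply, ContinuousLinearMap.mul_apply', one_mul])
  let G : Lp 𝕜 2 μ := (InnerProductSpace.toDual 𝕜 (Lp 𝕜 2 μ)).symm (φ ∘L ι)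
  obtain ⟨g, hgm, hg⟩ : ∃ g : α → 𝕜, Measurable g ∧ G =ᵐ[μ] g :=
    ⟨_, (Lp.stronglyMeasurable G).measurable, EventuallyEq.rfl⟩
  refine ⟨fun x => conj (g x), RCLike.continuous_conj.measurable.comp hgm,
    ((memLp_congr_ae hg).1 (Lp.memLp G)).star, fun f hf hf1 => ?_⟩
  have hιf : ι (hf.toLp f) = hf1.toLp f := by
    refine Lp.ext ?_
    filter_upwards [hι (hf.toLp f), hf.coeFn_toLp, hf1.coeFn_toLp] with x h1 h2 h3
    rw [h1, h2, h3]
  have hinner : inner 𝕜 G (hf.toLp f) = φ (ι (hf.toLp f)) :=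
    InnerProductSpace.toDual_symm_apply
  rw [← hιf, ← hinner, L2.inner_def]
  refine integral_congr_ae ?_
  filter_upwards [hg, hf.coeFn_toLp] with x h1 h2
  rw [RCLike.inner_apply, h1, h2, mul_comm]

theorem eq_lpPairing_of_forall_indicator {φ : Lp 𝕜 1 μ →L[𝕜] 𝕜} (ψ : Lp 𝕜 ∞ μ)
    (h : ∀ (c : 𝕜) {s : Set α} (hs : MeasurableSet s),
      φ (indicatorConstLp 1 hs (measure_ne_top μ s) c) =
        ∫ x, ψ x * s.indicator (fun _ => c) x ∂μ) (f : Lp 𝕜 1 μ) :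
    φ f = ∫ x, ψ x * f x ∂μ := by
  have hpair := (ContinuousLinearMap.mul 𝕜 𝕜).lpPairing_eq_integral (p := ∞) (q := 1) ψ
  refine Eq.trans ?_ (hpair f)
  refine Lp.induction ENNReal.one_ne_top (motive := fun f =>
    φ f = (ContinuousLinearMap.mul 𝕜 𝕜).lpPairing μ ∞ 1 ψ f) (fun c s hs hμs => ?_)
    (fun f g hf hg _ h1 h2 => by rw [map_add, map_add, h1, h2])
    (isClosed_eq (by fun_prop) (by fun_prop)) f
  rw [Lp.simpleFunc.coe_indicatorConst, hpair]
  refine (h c hs).trans (integral_congr_ae ?_)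
  filter_upwards [indicatorConstLp_coeFn (p := 1) (hs := hs) (hμs := hμs.ne) (c := c)] with x hx
  rw [hx, ContinuousLinearMap.mul_apply']

theorem exists_bounded_forall_apply_eq_integral_mul (φ : Lp 𝕜 1 μ →L[𝕜] 𝕜) :
    ∃ ψ : α → 𝕜, Measurable ψ ∧ (∀ x, ‖ψ x‖ ≤ ‖φ‖) ∧
      ∀ f : Lp 𝕜 1 μ, φ f = ∫ x, ψ x * f x ∂μ := by
  obtain ⟨g, hgm, hg2, hg⟩ := exists_memLp_two_forall_apply_eq_integral_mul φ
  have hbound : ∀ᵐ x ∂μ, ‖g x‖ ≤ ‖φ‖ := by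
    refine ae_norm_le_of_forall_norm_integral_mul_le (norm_nonneg φ) hgm
      (hg2.integrable one_le_two) fun f hfm hf => ?_
    have hfLp (p) : MemLp f p μ := .of_bound hfm.aestronglyMeasurable 1 (.of_forall hf)
    rw [← hg f (hfLp 2) (hfLp 1)]
    refine (φ.le_opNorm _).trans_eq (congrArg _ ?_)
    rw [L1.norm_eq_integral_norm]
    exact integral_congr_ae ((hfLp 1).coeFn_toLp.fun_comp _)
  set B : Set α := {x | ‖g x‖ ≤ ‖φ‖}
  have hψm : Measurable (B.indicator g) :=
    hgm.indicator (measurableSet_le hgm.norm measurable_const)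
  have hψb : ∀ x, ‖B.indicator g x‖ ≤ ‖φ‖ := fun x => by
    by_cases hx : x ∈ B
    · rwa [Set.indicator_of_mem hx]
    · simp [hx]
  have hψLp : MemLp (B.indicator g) ∞ μ :=
    .of_bound hψm.aestronglyMeasurable ‖φ‖ (.of_forall hψb)
  refine ⟨_, hψm, hψb, fun f => (eq_lpPairing_of_forall_indicator (hψLp.toLp _) ?_ f).trans
    (integral_congr_ae ?_)⟩
  · intro c s hs
    refine (hg _ (memLp_indicator_const 2 hs c (Or.inr (measure_ne_top μ s))) _).trans
      (integral_congr_ae ?_)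
    filter_upwards [hψLp.coeFn_toLp, hbound] with x h1 h2
    rw [h1, Set.indicator_of_mem (show x ∈ B from h2)]
  · filter_upwards [hψLp.coeFn_toLp] with x hx
    rw [hx]

end L1Dual

section Peaks

open Filter
open scoped ENNReal

variable {α 𝕜 E : Type*} {_ : MeasurableSpace α} {μ : Measure α} [RCLike 𝕜]
  [NormedAddCommGroup E] [NormedSpace 𝕜 E]

theorem norm_integral_mul_le_of_norm_sub_le {ψ : α → 𝕜} {C ε : ℝ} {c : 𝕜} {A : Set α}
    (hψ : Measurable ψ) (hψC : ∀ x, ‖ψ x‖ ≤ C) (hA : MeasurableSet A) (hε : 0 ≤ ε)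
    (hc : ∀ x ∈ A, ‖ψ x - c‖ ≤ ε) (w : Lp 𝕜 1 μ) :
    ‖∫ x, ψ x * w x ∂μ‖ ≤
      ε * ‖w‖ + (C + ‖c‖) * ∫ x in Aᶜ, ‖w x‖ ∂μ + ‖c‖ * ‖∫ x, w x ∂μ‖ := by
  have hw : Integrable w μ := L1.integrable_coeFn w
  have hψw : Integrable (fun x => ψ x * w x) μ :=
    hw.bdd_mul hψ.aestronglyMeasurable (.of_forall hψC)
  have hwA : Integrable (Aᶜ.indicator fun x => ‖w x‖) μ := hw.norm.indicator hA.compl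
  have hpointwise : ∀ x, ‖ψ x * w x - c * w x‖ ≤
      ε * ‖w x‖ + (C + ‖c‖) * Aᶜ.indicator (fun x => ‖w x‖) x := fun x => by
    rw [← sub_mul, norm_mul]
    by_cases hx : x ∈ A
    · simpa [hx] using mul_le_mul_of_nonneg_right (hc x hx) (norm_nonneg (w x))
    · have : ‖ψ x - c‖ ≤ C + ‖c‖ := (norm_sub_le _ _).trans (by gcongr; exact hψC x)
      rw [Set.indicator_of_mem (Set.mem_compl hx)]
      nlinarith [norm_nonneg (w x), mul_nonneg hε (norm_nonneg (w x))]
  have hsub : ‖∫ x, (ψ x * w x - c * w x) ∂μ‖ ≤ ε * ‖w‖ + (C + ‖c‖) * ∫ x in Aᶜ, ‖w x‖ ∂μ := by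
    rw [L1.norm_eq_integral_norm, ← integral_const_mul, ← integral_indicator hA.compl,
      ← integral_const_mul, ← integral_add (hw.norm.const_mul _) (hwA.const_mul _)]
    exact norm_integral_le_of_norm_le ((hw.norm.const_mul _).add (hwA.const_mul _))
      (.of_forall hpointwise)
  rw [integral_sub hψw (hw.const_mul c), integral_const_mul] at hsub
  rw [← norm_mul]
  linarith [norm_le_norm_sub_add (∫ x, ψ x * w x ∂μ) (c * ∫ x, w x ∂μ)]

theorem setIntegral_compl_norm_indicatorConstLp_sub {A : Set α} (hA : MeasurableSet A)
    (hμA : μ A ≠ ∞) (c : 𝕜) (z : Lp 𝕜 1 μ) :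
    ∫ t in Aᶜ, ‖(indicatorConstLp 1 hA hμA c - z : Lp 𝕜 1 μ) t‖ ∂μ = ∫ t in Aᶜ, ‖z t‖ ∂μ := by
  refine setIntegral_congr_ae hA.compl ?_
  filter_upwards [Lp.coeFn_sub (indicatorConstLp 1 hA hμA c) z,
    indicatorConstLp_coeFn (p := 1) (hs := hA) (hμs := hμA) (c := c)] with t h1 h2 ht
  rw [h1, Pi.sub_apply, h2, Set.indicator_of_notMem ht, zero_sub, norm_neg]

theorem integral_indicatorConstLp_one_sub {A : Set α} (hA : MeasurableSet A) (hμA : μ A ≠ ∞)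
    (z : Lp 𝕜 1 μ) : ∫ t, (indicatorConstLp 1 hA hμA (1 : 𝕜) - z : Lp 𝕜 1 μ) t ∂μ =
      μ.real A - ∫ t, z t ∂μ := by
  rw [integral_congr_ae (Lp.coeFn_sub _ z), Pi.sub_def,
    integral_sub (L1.integrable_coeFn _) (L1.integrable_coeFn z), integral_indicatorConstLp,
    ← RCLike.ofReal_alg]

theorem norm_toLp_add_of_disjoint_support {f g : α → 𝕜} (hf : MemLp f 1 μ) (hg : MemLp g 1 μ)
    (h : Disjoint (Function.support f) (Function.support g)) :
    ‖hf.toLp f + hg.toLp g‖ = ‖hf.toLp f‖ + ‖hg.toLp g‖ := by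
  have hf' : Integrable f μ := memLp_one_iff_integrable.1 hf
  have hg' : Integrable g μ := memLp_one_iff_integrable.1 hg
  have hnorm {k : α → 𝕜} (hk : MemLp k 1 μ) : ‖hk.toLp k‖ = ∫ x, ‖k x‖ ∂μ := by
    rw [L1.norm_eq_integral_norm]
    exact integral_congr_ae (hk.coeFn_toLp.fun_comp _)
  rw [← MemLp.toLp_add, hnorm, hnorm, hnorm, ← integral_add hf'.norm hg'.norm]
  refine integral_congr_ae (.of_forall fun x => ?_)
  by_cases hx : f x = 0
  · simp [hx]
  · have : g x = 0 := Function.notMem_support.1 (Set.disjoint_left.1 h hx)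
    simp [this]

variable [IsFiniteMeasure μ]

/-- Up to small `T`-error, every indicator function `1_A` can be replaced by a function of almost
the same norm and the same integral that is concentrated on `A` and is almost `ℓ¹`-orthogonal to a
prescribed function. The integral makes the new function almost nonnegative. -/
def HasPeaks (T : Lp 𝕜 1 μ →L[𝕜] E) : Prop :=
  ∀ (A : Set α) (hA : MeasurableSet A) (x : Lp 𝕜 1 μ) (δ : ℝ), 0 < δ → ∃ z : Lp 𝕜 1 μ,
    ‖z‖ ≤ μ.real A + δ ∧ ‖T (indicatorConstLp 1 hA (measure_ne_top μ A) 1 - z)‖ ≤ δ ∧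
      ∫ t in Aᶜ, ‖z t‖ ∂μ ≤ δ ∧ ‖∫ t, z t ∂μ - μ.real A‖ ≤ δ ∧ ‖x‖ + μ.real A - δ ≤ ‖x + z‖

theorem norm_indicatorConstLp_one {A : Set α} (hA : MeasurableSet A) :
    ‖indicatorConstLp 1 hA (measure_ne_top μ A) (1 : 𝕜)‖ = μ.real A := by
  rw [norm_indicatorConstLp one_ne_zero ENNReal.one_ne_top]
  simp

namespace HasPeaks

variable {T : Lp 𝕜 1 μ →L[𝕜] E} {φ : Lp 𝕜 1 μ →L[𝕜] 𝕜} {ψ : α → 𝕜} {C ε : ℝ}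

theorem isReplaceable_of_norm_sub_le (hT : HasPeaks T) (hψ : Measurable ψ) (hψC : ∀ x, ‖ψ x‖ ≤ C)
    (hφ : ∀ f, φ f = ∫ x, ψ x * f x ∂μ) (hε : 0 ≤ ε) {c : 𝕜} {A : Set α} (hA : MeasurableSet A)
    (hc : ∀ x ∈ A, ‖ψ x - c‖ ≤ ε) :
    IsReplaceable T φ (2 * ε) (indicatorConstLp 1 hA (measure_ne_top μ A) (1 : 𝕜)) := by
  intro x δ hδ
  set K : ℝ := 1 + ε + |C| + 2 * ‖c‖
  have hK1 : 1 ≤ K := by linarith [abs_nonneg C, norm_nonneg c]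
  set η : ℝ := δ / K
  have hη0 : 0 < η := by positivity
  have hηK : K * η = δ := mul_div_cancel₀ δ (by positivity)
  have hηδ : η ≤ δ := by nlinarith
  obtain ⟨z, hz, hTz, hzA, hzint, hxz⟩ := hT A hA x η hη0
  set y := indicatorConstLp 1 hA (measure_ne_top μ A) (1 : 𝕜) with hy
  have hynorm : ‖y‖ = μ.real A := norm_indicatorConstLp_one hA
  have hoff : ∫ t in Aᶜ, ‖(y - z : Lp 𝕜 1 μ) t‖ ∂μ ≤ η :=
    (setIntegral_compl_norm_indicatorConstLp_sub hA _ 1 z).trans_le hzA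
  have h_integral : ‖∫ t, (y - z : Lp 𝕜 1 μ) t ∂μ‖ ≤ η := by
    rwa [hy, integral_indicatorConstLp_one_sub, norm_sub_rev]
  refine ⟨z, by linarith, hTz.trans hηδ, ?_, by linarith⟩
  have hmain := norm_integral_mul_le_of_norm_sub_le hψ hψC hA hε hc (y - z)
  have hCc : (C + ‖c‖) * ∫ t in Aᶜ, ‖(y - z : Lp 𝕜 1 μ) t‖ ∂μ ≤ (|C| + ‖c‖) * η := by
    have := le_abs_self C
    have : 0 ≤ ∫ t in Aᶜ, ‖(y - z : Lp 𝕜 1 μ) t‖ ∂μ := integral_nonneg fun t => norm_nonneg _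
    gcongr
  rw [hφ]
  nlinarith [norm_sub_le y z, mul_le_mul_of_nonneg_left h_integral (norm_nonneg c)]

theorem isReplaceable_indicator (hT : HasPeaks T) (hε : 0 < ε) {A : Set α} (hA : MeasurableSet A) :
    IsReplaceable T φ ε (indicatorConstLp 1 hA (measure_ne_top μ A) (1 : 𝕜)) := by
  obtain ⟨ψ, hψ, hψC, hφ⟩ := exists_bounded_forall_apply_eq_integral_mul φ
  obtain ⟨t, ht⟩ : ∃ t : Finset 𝕜, Metric.closedBall 0 ‖φ‖ ⊆ ⋃ c ∈ t, Metric.ball c (ε / 2) := by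
    obtain ⟨t, -, htf, ht⟩ := (isCompact_closedBall (0 : 𝕜) ‖φ‖).finite_cover_balls (half_pos hε)
    exact ⟨htf.toFinset, by simpa using ht⟩
  have hcover : ∀ x ∈ A, ψ x ∈ ⋃ c ∈ t, Metric.ball c (ε / 2) := fun x _ =>
    ht (by simpa using hψC x)
  clear ht
  induction t using Finset.induction_on generalizing A with
  | empty =>
    obtain rfl : A = ∅ := Set.eq_empty_of_forall_notMem fun x hx => by simpa using hcover x hx
    rw [indicatorConstLp_empty]
    exact IsReplaceable.zero
  | insert c t _ ih =>
    set B : Set α := ψ ⁻¹' Metric.ball c (ε / 2)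
    have hB : MeasurableSet B := hψ Metric.isOpen_ball.measurableSet
    have hAB : Disjoint (A ∩ B) (A \ B) := Set.disjoint_sdiff_right.mono_left Set.inter_subset_right
    have hnear := hT.isReplaceable_of_norm_sub_le hψ hψC hφ (half_pos hε).le (c := c) (hA.inter hB)
      fun x hx => by simpa [dist_eq_norm] using (Metric.mem_ball.1 hx.2).le
    have hfar := ih (hA.diff hB) fun x hx => by
      have hxB : ψ x ∉ Metric.ball c (ε / 2) := hx.2
      simpa [hxB] using hcover x hx.1
    have hsplit : indicatorConstLp 1 hA (measure_ne_top μ A) (1 : 𝕜) =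
        indicatorConstLp 1 (hA.inter hB) (measure_ne_top μ _) 1 +
          indicatorConstLp 1 (hA.diff hB) (measure_ne_top μ _) 1 := by
      rw [← indicatorConstLp_disjoint_union _ _ _ _ hAB]
      congr 1
      exact (Set.inter_union_sdiff A B).symm
    rw [mul_div_cancel₀ ε two_ne_zero] at hnear
    rw [hsplit]
    refine hnear.add hfar ?_
    rw [← hsplit, norm_indicatorConstLp_one, norm_indicatorConstLp_one, norm_indicatorConstLp_one,
      measureReal_inter_add_sdiff hB]

theorem isReplaceable (hT : HasPeaks T) (hε : 0 < ε) (y : Lp 𝕜 1 μ) : IsReplaceable T φ ε y := by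
  refine Lp.induction ENNReal.one_ne_top (motive := fun y => IsReplaceable T φ ε y)
    (fun c s hs hμs => ?_)
    (fun f g hf hg hfg hfr hgr => hfr.add hgr (norm_toLp_add_of_disjoint_support hf hg hfg))
    (IsReplaceable.isClosed_setOf hε.le) y
  have hsmul : indicatorConstLp 1 hs hμs.ne c = c • indicatorConstLp 1 hs hμs.ne (1 : 𝕜) := by
    rw [indicatorConstLp, indicatorConstLp, ← MemLp.toLp_const_smul]
    congr 1
    exact funext fun x => by by_cases hx : x ∈ s <;> simp [hx]
  rw [Lp.simpleFunc.coe_indicatorConst, hsmul]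
  exact (hT.isReplaceable_indicator hε hs).smul c

end HasPeaks

end Peaks

section NullSingletons

open scoped ENNReal

variable {α 𝕜 E : Type*} {_ : MeasurableSpace α} {μ : Measure α} [RCLike 𝕜]
  [NormedAddCommGroup E] [NormedSpace 𝕜 E]

theorem exists_measurableSet_subset_measure_lt [TopologicalSpace α] [CompactSpace α]
    [OpensMeasurableSpace α] [NullSingletonClass μ] [μ.OuterRegular] {A : Set α}
    (hA : MeasurableSet A) (hA0 : μ A ≠ 0) {r : ℝ≥0∞} (hr : 0 < r) :
    ∃ B ⊆ A, MeasurableSet B ∧ μ B ≠ 0 ∧ μ B < r := by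
  have hU : ∀ p : α, ∃ U, p ∈ U ∧ IsOpen U ∧ μ U < r := fun p => by
    obtain ⟨U, hpU, hU, hUr⟩ := Set.exists_isOpen_lt_of_lt {p} r
      (by rwa [measure_singleton] : μ {p} < r)
    exact ⟨U, hpU rfl, hU, hUr⟩
  choose U hpU hUo hUr using hU
  obtain ⟨t, ht⟩ := isCompact_univ.elim_finite_subcover U hUo
    fun p _ => Set.mem_iUnion.2 ⟨p, hpU p⟩
  obtain ⟨p, -, hp⟩ : ∃ p ∈ t, μ (A ∩ U p) ≠ 0 := by
    by_contra! hcon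
    refine hA0 (measure_mono_null (t := ⋃ p ∈ t, A ∩ U p) (fun s hs => ?_)
      ((measure_biUnion_null_iff t.countable_toSet).2 hcon))
    obtain ⟨p, hp, hs'⟩ := Set.mem_iUnion₂.1 (ht (Set.mem_univ s))
    exact Set.mem_iUnion₂.2 ⟨p, hp, hs, hs'⟩
  exact ⟨A ∩ U p, Set.inter_subset_left, hA.inter (hUo p).measurableSet, hp,
    (measure_mono Set.inter_subset_right).trans_lt (hUr p)⟩

theorem norm_add_norm_le_norm_add_add_setIntegral {B : Set α} (hB : MeasurableSet B)
    (x : Lp 𝕜 1 μ) {z : Lp 𝕜 1 μ} (hz : ∀ᵐ s ∂μ, s ∉ B → z s = 0) :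
    ‖x‖ + ‖z‖ ≤ ‖x + z‖ + 2 * ∫ s in B, ‖x s‖ ∂μ := by
  have hx := (L1.integrable_coeFn x).norm
  have hxz := (L1.integrable_coeFn (x + z)).norm
  have hxB : Integrable (fun s => 2 * B.indicator (fun s => ‖x s‖) s) μ :=
    (hx.indicator hB).const_mul 2
  simp only [L1.norm_eq_integral_norm]
  rw [← integral_add hx (L1.integrable_coeFn z).norm, ← integral_indicator hB,
    ← integral_const_mul, ← integral_add hxz hxB]
  refine integral_mono_ae (hx.add (L1.integrable_coeFn z).norm) (hxz.add hxB) ?_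
  filter_upwards [hz, Lp.coeFn_add x z] with s hzs hadd
  simp only [hadd, Pi.add_apply]
  by_cases hs : s ∈ B
  · rw [Set.indicator_of_mem hs]
    have := norm_sub_le (x s + z s) (x s)
    rw [add_sub_cancel_left] at this
    linarith
  · rw [Set.indicator_of_notMem hs, hzs hs]
    simp

theorem hasPeaks_zero [TopologicalSpace α] [CompactSpace α] [OpensMeasurableSpace α]
    [IsFiniteMeasure μ] [NullSingletonClass μ] [μ.OuterRegular] :
    HasPeaks (0 : Lp 𝕜 1 μ →L[𝕜] E) := by
  intro A hA x δ hδ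
  rcases eq_or_ne (μ A) 0 with hA0 | hA0
  · have h0 : (0 : Lp 𝕜 1 μ) =ᵐ[μ] 0 := Lp.coeFn_zero 𝕜 1 μ
    have hA' : μ.real A = 0 := by rw [measureReal_def, hA0, ENNReal.toReal_zero]
    refine ⟨0, by simpa [hA'] using hδ.le, by simpa using hδ.le, ?_, ?_, by simp [hA', hδ.le]⟩
    · rw [integral_eq_zero_of_ae (ae_restrict_of_ae <| h0.mono fun t ht => by rw [ht]; simp)]
      exact hδ.le
    · rw [integral_eq_zero_of_ae h0, hA', RCLike.ofReal_zero, sub_zero, norm_zero]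
      exact hδ.le
  obtain ⟨r, hr0, hr⟩ := exists_pos_setLIntegral_lt_of_measure_lt (μ := μ)
    (f := fun t => ‖x t‖ₑ) (L1.integrable_coeFn x).2.ne (ε := ENNReal.ofReal (δ / 2))
    (by simpa using hδ)
  obtain ⟨B, hBA, hB, hB0, hBr⟩ := exists_measurableSet_subset_measure_lt hA hA0 hr0
  have hBx : ∫ s in B, ‖x s‖ ∂μ ≤ δ / 2 := by
    rw [integral_norm_eq_lintegral_enorm (L1.integrable_coeFn x).aestronglyMeasurable.restrict]
    exact ENNReal.toReal_le_of_le_ofReal (by positivity) (hr B hBr).le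
  have hBpos : μ.real B ≠ 0 := (ENNReal.toReal_pos hB0 (measure_ne_top μ B)).ne'
  let c : 𝕜 := ((μ.real A / μ.real B : ℝ) : 𝕜)
  have hzB : ∀ᵐ s ∂μ, s ∉ B → indicatorConstLp 1 hB (measure_ne_top μ B) c s = 0 := by
    filter_upwards [indicatorConstLp_coeFn (p := 1) (hs := hB) (hμs := measure_ne_top μ B)
      (c := c)] with s hs hsB
    rw [hs, Set.indicator_of_notMem hsB]
  have hznorm : ‖indicatorConstLp 1 hB (measure_ne_top μ B) c‖ = μ.real A := by
    rw [norm_indicatorConstLp one_ne_zero ENNReal.one_ne_top,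
      RCLike.norm_of_nonneg (by positivity), ENNReal.toReal_one, div_one, Real.rpow_one,
      div_mul_cancel₀ _ hBpos]
  refine ⟨indicatorConstLp 1 hB (measure_ne_top μ B) c, by linarith, by simpa using hδ.le, ?_, ?_,
    by linarith [norm_add_norm_le_norm_add_add_setIntegral hB x hzB]⟩
  · rw [setIntegral_eq_zero_of_ae_eq_zero]
    · exact hδ.le
    · filter_upwards [hzB] with s hs hsA
      rw [hs fun h => hsA (hBA h), norm_zero]
  · rw [integral_indicatorConstLp, RCLike.real_smul_eq_coe_mul, ← RCLike.ofReal_mul,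
      mul_div_cancel₀ _ hBpos, sub_self, norm_zero]
    exact hδ.le

theorem norm_le_norm_integral_add_setIntegral_compl_singleton [MeasurableSingletonClass α] (p : α)
    (w : Lp 𝕜 1 μ) : ‖w‖ ≤ ‖∫ t, w t ∂μ‖ + 2 * ∫ t in {p}ᶜ, ‖w t‖ ∂μ := by
  have hp : MeasurableSet {p} := measurableSet_singleton p
  have hw := L1.integrable_coeFn w
  have hatom : ∫ t in {p}, ‖w t‖ ∂μ = ‖∫ t in {p}, w t ∂μ‖ := by
    rw [integral_singleton, integral_singleton, norm_smul, smul_eq_mul,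
      Real.norm_of_nonneg measureReal_nonneg]
  have hle : ‖∫ t in {p}, w t ∂μ‖ ≤ ‖∫ t, w t ∂μ‖ + ∫ t in {p}ᶜ, ‖w t‖ ∂μ := by
    rw [← add_sub_cancel_right (∫ t in {p}, w t ∂μ) (∫ t in {p}ᶜ, w t ∂μ), integral_add_compl hp hw]
    exact (norm_sub_le _ _).trans (by gcongr; exact norm_integral_le_integral_norm _)
  rw [L1.norm_eq_integral_norm, ← integral_add_compl hp hw.norm, hatom]
  linarith

theorem not_hasPeaks_of_measure_singleton_ne_zero [MeasurableSingletonClass α] [IsFiniteMeasure μ]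
    {p : α} (hp : μ {p} ≠ 0) (T : Lp 𝕜 1 μ →L[𝕜] E) : ¬ HasPeaks T := by
  intro hT
  have hpos : 0 < μ.real {p} := ENNReal.toReal_pos hp (measure_ne_top μ {p})
  set y := indicatorConstLp 1 (measurableSet_singleton p) (measure_ne_top μ {p}) (1 : 𝕜) with hy
  obtain ⟨z, -, -, hzp, hzint, hyz⟩ := hT {p} (measurableSet_singleton p) (-y)
    (μ.real {p} / 4) (by positivity)
  have hle := norm_le_norm_integral_add_setIntegral_compl_singleton p (y - z)
  rw [hy, integral_indicatorConstLp_one_sub, setIntegral_compl_norm_indicatorConstLp_sub,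
    norm_sub_rev _ (∫ t, z t ∂μ)] at hle
  rw [norm_neg, hy, norm_indicatorConstLp_one, ← norm_neg, neg_add, neg_neg, ← sub_eq_add_neg]
    at hyz
  linarith

end NullSingletons

noncomputable section Slices

open scoped ENNReal

theorem exists_linearIsometry_of_denseRange {𝕜 V A B : Type*} [NontriviallyNormedField 𝕜]
    [AddCommGroup V] [Module 𝕜 V] [NormedAddCommGroup A] [NormedSpace 𝕜 A] [NormedAddCommGroup B]
    [NormedSpace 𝕜 B] [CompleteSpace B] {e : V →ₗ[𝕜] A} (he : DenseRange e) (f : V →ₗ[𝕜] B)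
    (hf : ∀ v, ‖f v‖ = ‖e v‖) : ∃ S : A →ₗᵢ[𝕜] B, ∀ v, S (e v) = f v := by
  have hext := LinearMap.extendOfNorm_eq he ⟨1, fun v => by rw [one_mul, hf v]⟩ (f := f)
  refine ⟨⟨f.extendOfNorm e, fun a => ?_⟩, hext⟩
  exact he.induction_on a (isClosed_eq (f.extendOfNorm e).continuous.norm continuous_norm)
    fun v => (congrArg norm (hext v)).trans (hf v)

section

variable {Y E : Type*} [TopologicalSpace Y] [CompactSpace Y] [MeasurableSpace Y] [BorelSpace Y]
  [NormedAddCommGroup E] [NormedSpace ℂ E] (ν : Measure Y) [IsFiniteMeasure ν]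

/-- The class in `L¹` of a continuous function. Unlike `ContinuousMap.toLp` it does not ask for a
second countable domain or codomain. -/
def continuousToL1 : C(Y, E) →ₗ[ℂ] Lp E 1 ν where
  toFun f := (f.continuous.integrable_of_hasCompactSupport (.of_compactSpace f)).toL1 f
  map_add' _ _ := rfl
  map_smul' _ _ := rfl

theorem coeFn_continuousToL1 (f : C(Y, E)) : continuousToL1 ν f =ᵐ[ν] f :=
  (f.continuous.integrable_of_hasCompactSupport (.of_compactSpace f)).coeFn_toL1

/-- The pairing `(k, f) ↦ ∫ k • f` of continuous functions with vector-valued `L¹` functions. -/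
def integralSMulL [CompleteSpace E] : C(Y, ℂ) →L[ℂ] Lp E 1 ν →L[ℂ] E :=
  (ContinuousLinearMap.lsmul ℂ ℂ).lpPairing ν ∞ 1 ∘L ContinuousMap.toLp ∞ ν ℂ

theorem integralSMulL_apply [CompleteSpace E] (k : C(Y, ℂ)) (f : Lp E 1 ν) :
    integralSMulL ν k f = ∫ x, k x • f x ∂ν := by
  rw [integralSMulL, ContinuousLinearMap.comp_apply, ContinuousLinearMap.lpPairing_eq_integral]
  refine integral_congr_ae ?_
  filter_upwards [ContinuousMap.coeFn_toLp (p := ∞) (𝕜 := ℂ) ν k] with x hx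
  rw [hx, ContinuousLinearMap.lsmul_apply]

theorem apply_integralSMulL [CompleteSpace E] {E' : Type*} [NormedAddCommGroup E']
    [NormedSpace ℂ E'] [CompleteSpace E'] (T : E →L[ℂ] E') (k : C(Y, ℂ)) (f : Lp E 1 ν) :
    T (integralSMulL ν k f) = ∫ y, k y • T (f y) ∂ν := by
  have h_integrable : Integrable (fun y => k y • f y) ν := (L1.integrable_coeFn f).bdd_smul ‖k‖
    k.continuous.aestronglyMeasurable (.of_forall k.norm_coe_le_norm)
  rw [integralSMulL_apply, ← T.integral_comp_comm h_integrable]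
  simp only [map_smul]

end

variable {X Y : Type*} [TopologicalSpace X] [CompactSpace X] [MeasurableSpace X] [BorelSpace X]
  (μ : Measure X) [IsFiniteMeasure μ] [TopologicalSpace Y]

theorem norm_toLp_one (f : C(X, ℂ)) :
    ‖ContinuousMap.toLp 1 μ ℂ f‖ = ∫ x, ‖f x‖ ∂μ := by
  rw [L1.norm_eq_integral_norm]
  exact integral_congr_ae ((ContinuousMap.coeFn_toLp μ f).fun_comp norm)

theorem integralSMulL_toLp (k f : C(X, ℂ)) :
    integralSMulL μ k (ContinuousMap.toLp 1 μ ℂ f) = ∫ x, k x * f x ∂μ := by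
  rw [integralSMulL_apply]
  refine integral_congr_ae ?_
  filter_upwards [ContinuousMap.coeFn_toLp (p := 1) (𝕜 := ℂ) μ f] with x hx
  rw [hx, smul_eq_mul]

/-- The slices `y ↦ F(·, y)` of a continuous function on a product, as an `L¹`-valued function. -/
def continuousSlices : C(X × Y, ℂ) →ₗ[ℂ] C(Y, Lp ℂ 1 μ) :=
  ((ContinuousMap.toLp (E := ℂ) 1 μ ℂ).compLeftContinuous ℂ Y).toLinearMap ∘ₗ
    { toFun := fun F => (F.comp .prodSwap).curry, map_add' := fun _ _ => rfl,
      map_smul' := fun _ _ => rfl }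

theorem continuousSlices_apply (F : C(X × Y, ℂ)) (y : Y) :
    continuousSlices μ F y = ContinuousMap.toLp 1 μ ℂ ((F.comp .prodSwap).curry y) := rfl

variable [CompactSpace Y] [MeasurableSpace Y] [BorelSpace Y] (ν : Measure Y) [IsFiniteMeasure ν]
  [MeasurableSpace (X × Y)] [BorelSpace (X × Y)] (ρ : Measure (X × Y))

/-- The Borel measure `ρ` integrates continuous functions as the product of `μ` and `ν` does.
This replaces `ρ = μ.prod ν`, since the Borel `σ`-algebra of a product of nonmetrizable compact
spaces can be larger than the product `σ`-algebra. -/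
def IsProductIntegral : Prop :=
  ∀ F : C(X × Y, ℂ), ∫ p, F p ∂ρ = ∫ y, ∫ x, F (x, y) ∂μ ∂ν

variable {μ ν ρ} [IsFiniteMeasure ρ]

namespace IsProductIntegral

theorem norm_continuousToL1_continuousSlices (h : IsProductIntegral μ ν ρ) (F : C(X × Y, ℂ)) :
    ‖continuousToL1 ν (continuousSlices μ F)‖ = ‖ContinuousMap.toLp 1 ρ ℂ F‖ := by
  have h_integral : ∫ p, ‖F p‖ ∂ρ = ∫ y, ∫ x, ‖F (x, y)‖ ∂μ ∂ν := by
    have hF := h ⟨fun p => (‖F p‖ : ℂ), by fun_prop⟩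
    simp only [ContinuousMap.coe_mk, integral_complex_ofReal] at hF
    exact_mod_cast hF
  rw [norm_toLp_one, h_integral, L1.norm_eq_integral_norm]
  refine integral_congr_ae ?_
  filter_upwards [coeFn_continuousToL1 ν (continuousSlices μ F)] with y hy
  rw [hy, continuousSlices_apply, norm_toLp_one]
  rfl

variable [T2Space X] [T2Space Y] [ρ.WeaklyRegular]

theorem exists_slices (h : IsProductIntegral μ ν ρ) : ∃ S : Lp ℂ 1 ρ →ₗᵢ[ℂ] Lp (Lp ℂ 1 μ) 1 ν,
    ∀ F, S (ContinuousMap.toLp 1 ρ ℂ F) = continuousToL1 ν (continuousSlices μ F) :=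
  exists_linearIsometry_of_denseRange
    (e := (ContinuousMap.toLp (E := ℂ) 1 ρ ℂ).toLinearMap)
    (ContinuousMap.toLp_denseRange ℂ ρ ℂ ENNReal.one_ne_top)
    (continuousToL1 ν ∘ₗ continuousSlices μ) h.norm_continuousToL1_continuousSlices

/-- The slices `y ↦ F(·, y)` of an `L¹` function `F` on a product. They are the continuous extension
of the slices of continuous functions, which needs no Fubini theorem for `ρ`. -/
def slices (h : IsProductIntegral μ ν ρ) : Lp ℂ 1 ρ →ₗᵢ[ℂ] Lp (Lp ℂ 1 μ) 1 ν :=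
  h.exists_slices.choose

theorem slices_toLp (h : IsProductIntegral μ ν ρ) (F : C(X × Y, ℂ)) :
    h.slices (ContinuousMap.toLp 1 ρ ℂ F) = continuousToL1 ν (continuousSlices μ F) :=
  h.exists_slices.choose_spec F

theorem slices_compMeasurePreserving [μ.WeaklyRegular] (h : IsProductIntegral μ ν ρ)
    (hfst : MeasurePreserving Prod.fst ρ μ) (f : Lp ℂ 1 μ) :
    h.slices (Lp.compMeasurePreserving Prod.fst hfst f) = Lp.const 1 ν f := by
  refine (ContinuousMap.toLp_denseRange ℂ μ ℂ ENNReal.one_ne_top).induction_on f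
    (isClosed_eq ?_ (Lp.constL 1 ν ℂ).continuous) fun g => ?_
  · exact h.slices.continuous.comp (Lp.isometry_compMeasurePreserving hfst).continuous
  · have hcomp : Lp.compMeasurePreserving Prod.fst hfst (ContinuousMap.toLp 1 μ ℂ g) =
        ContinuousMap.toLp 1 ρ ℂ (g.comp .fst) := rfl
    rw [hcomp, h.slices_toLp]
    rfl

theorem integralSMulL_slices (h : IsProductIntegral μ ν ρ) (a : C(X, ℂ)) (k : C(Y, ℂ))
    (F : Lp ℂ 1 ρ) : integralSMulL μ a (integralSMulL ν k (h.slices F)) =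
      integralSMulL ρ (a.comp .fst * k.comp .snd) F := by
  have hcont : Continuous fun F => integralSMulL μ a (integralSMulL ν k (h.slices F)) :=
    (integralSMulL μ a).continuous.comp ((integralSMulL ν k).continuous.comp h.slices.continuous)
  refine congrFun ((ContinuousMap.toLp_denseRange ℂ ρ ℂ ENNReal.one_ne_top).equalizer hcont
    (integralSMulL ρ (a.comp .fst * k.comp .snd)).continuous (funext fun F => ?_)) F
  calc integralSMulL μ a (integralSMulL ν k (h.slices (ContinuousMap.toLp 1 ρ ℂ F)))
      = ∫ y, k y • integralSMulL μ a (continuousSlices μ F y) ∂ν := by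
        rw [h.slices_toLp, apply_integralSMulL]
        refine integral_congr_ae ?_
        filter_upwards [coeFn_continuousToL1 ν (continuousSlices μ F)] with y hy
        rw [hy]
    _ = ∫ y, ∫ x, a x * k y * F (x, y) ∂μ ∂ν := by
        refine integral_congr_ae (.of_forall fun y => ?_)
        simp only [continuousSlices_apply, integralSMulL_toLp, ← integral_smul]
        exact integral_congr_ae (.of_forall fun x => (mul_left_comm ..).trans (mul_assoc ..).symm)
    _ = ∫ p, a p.1 * k p.2 * F p ∂ρ := (h (a.comp .fst * k.comp .snd * F)).symm
    _ = integralSMulL ρ (a.comp .fst * k.comp .snd) (ContinuousMap.toLp 1 ρ ℂ F) :=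
        (integralSMulL_toLp ρ (a.comp .fst * k.comp .snd) F).symm

end IsProductIntegral

end Slices

section RichSlices

variable {𝕜 V W E E' Y : Type*} [RCLike 𝕜] [NormedAddCommGroup V] [NormedSpace 𝕜 V]
  [NormedAddCommGroup W] [NormedSpace 𝕜 W] [NormedAddCommGroup E] [NormedSpace 𝕜 E]
  [NormedAddCommGroup E'] [NormedSpace 𝕜 E'] {_ : MeasurableSpace Y} {ν : Measure Y}

theorem exists_sub_mem_norm_lt_norm_mkQL_add (L : Submodule 𝕜 V) [IsClosed (L : Set V)] (v : V)
    {δ : ℝ} (hδ : 0 < δ) : ∃ w, v - w ∈ L ∧ ‖w‖ < ‖L.mkQL v‖ + δ := by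
  obtain ⟨w, hw, hwδ⟩ := Submodule.Quotient.norm_mk_lt (L.mkQL v) hδ
  exact ⟨w, (Submodule.Quotient.eq L).1 hw.symm, hwδ⟩

theorem norm_apply_le_norm_mkQL (L : Submodule 𝕜 V) [IsClosed (L : Set V)] {f : V →L[𝕜] E}
    (hf : ∀ v, ‖f v‖ ≤ ‖v‖) (hfL : ∀ v ∈ L, f v = 0) (v : V) : ‖f v‖ ≤ ‖L.mkQL v‖ := by
  refine le_of_forall_pos_le_add fun δ hδ => ?_
  obtain ⟨w, hwL, hw⟩ := exists_sub_mem_norm_lt_norm_mkQL_add L v hδ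
  rw [sub_eq_zero.1 ((map_sub f v w).symm.trans (hfL _ hwL))]
  exact (hf w).trans hw.le

theorem integral_norm_mkQL_le_norm_mkQL (S : V →ₗᵢ[𝕜] Lp W 1 ν) (L : Submodule 𝕜 V)
    [IsClosed (L : Set V)] (N : Submodule 𝕜 W) [IsClosed (N : Set W)]
    (hS : ∀ v ∈ L, ∀ᵐ s ∂ν, S v s ∈ N) (v : V) : ∫ s, ‖N.mkQL (S v s)‖ ∂ν ≤ ‖L.mkQL v‖ := by
  let f : V →L[𝕜] Lp (W ⧸ N) 1 ν := N.mkQL.compLpL 1 ν ∘L S.toContinuousLinearMap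
  have hf_coe (v : V) : ∀ᵐ s ∂ν, f v s = N.mkQL (S v s) := N.mkQL.coeFn_compLpL (S v)
  have hf_norm (v : V) : ‖f v‖ = ∫ s, ‖N.mkQL (S v s)‖ ∂ν := by
    rw [L1.norm_eq_integral_norm]
    exact integral_congr_ae ((hf_coe v).mono fun s hs => congrArg norm hs)
  rw [← hf_norm]
  refine norm_apply_le_norm_mkQL L (fun v => ?_) (fun v hv => ?_) v
  · rw [hf_norm, ← S.norm_map v, L1.norm_eq_integral_norm]
    have h_integrable := (L1.integrable_coeFn (f v)).norm.congr
      ((hf_coe v).mono fun s hs => congrArg norm hs)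
    exact integral_mono h_integrable (L1.integrable_coeFn (S v)).norm
      fun s => Submodule.Quotient.norm_mk_le N (S v s)
  · refine norm_eq_zero.1 ((hf_norm v).trans (integral_eq_zero_of_ae ?_))
    filter_upwards [hS v hv] with s hs
    exact norm_eq_zero.2 ((Submodule.Quotient.mk_eq_zero N).2 hs)

variable [IsProbabilityMeasure ν]

theorem exists_slice_of_integral_le (F : Lp W 1 ν) (Q : W →L[𝕜] E') (x y : W) {Ψ : W →L[𝕜] 𝕜}
    (hΨ : ∀ w, ‖Ψ w‖ ≤ ‖w‖) {δ : ℝ}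
    (hδ : ∫ s, ‖Q (y - F s)‖ ∂ν + (‖F‖ - RCLike.re (∫ s, Ψ (F s) ∂ν)) +
      (‖x‖ + ‖F‖ - ‖Lp.const 1 ν x + F‖) ≤ δ) :
    ∃ w, ‖Q (y - w)‖ ≤ δ ∧ ‖w‖ ≤ RCLike.re (Ψ w) + δ ∧ ‖x‖ + ‖w‖ - δ ≤ ‖x + w‖ := by
  have hF : Integrable F ν := L1.integrable_coeFn F
  have hΨF : Integrable (fun s => Ψ (F s)) ν := Ψ.integrable_comp hF
  have ha : Integrable (fun s => ‖Q (y - F s)‖) ν :=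
    (Q.integrable_comp ((integrable_const y).sub hF)).norm
  have hb : Integrable (fun s => ‖F s‖ - RCLike.re (Ψ (F s))) ν := hF.norm.sub hΨF.re
  have hc₁ : Integrable (fun s => ‖x‖ + ‖F s‖) ν := (integrable_const _).add hF.norm
  have hc₂ : Integrable (fun s => ‖x + F s‖) ν := ((integrable_const x).add hF).norm
  have hnorm_add : ‖Lp.const 1 ν x + F‖ = ∫ s, ‖x + F s‖ ∂ν := by
    rw [L1.norm_eq_integral_norm]
    refine integral_congr_ae ?_
    filter_upwards [Lp.coeFn_add (Lp.const 1 ν x) F, Lp.coeFn_const 1 ν x] with s hs hxs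
    rw [hs, Pi.add_apply, hxs, Function.const_apply]
  obtain ⟨s, hs⟩ := exists_le_integral ((ha.add hb).add (hc₁.sub hc₂))
  rw [integral_add' (ha.add hb) (hc₁.sub hc₂), integral_add' ha hb, integral_sub' hc₁ hc₂,
    integral_sub hF.norm hΨF.re, integral_re hΨF, integral_add (integrable_const _) hF.norm,
    integral_const, probReal_univ, one_smul, ← hnorm_add, ← L1.norm_eq_integral_norm] at hs
  simp only [Pi.add_apply, Pi.sub_apply] at hs
  have hQ_nonneg := norm_nonneg (Q (y - F s))
  have hΨ_le := (RCLike.re_le_norm (Ψ (F s))).trans (hΨ (F s))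
  have h_add := norm_add_le x (F s)
  exact ⟨F s, by linarith, by linarith, by linarith⟩

theorem IsNarrow.exists_slice {T : V →L[𝕜] E} (hT : IsNarrow T) (S : V →ₗᵢ[𝕜] Lp W 1 ν)
    {Q : W →L[𝕜] E'} (hQ : ∀ v, ∫ s, ‖Q (S v s)‖ ∂ν ≤ ‖T v‖) {x y : W} {x' y' : V}
    (hx : S x' = Lp.const 1 ν x) (hy : S y' = Lp.const 1 ν y) {Ψ : W →L[𝕜] 𝕜}
    (hΨ : ∀ w, ‖Ψ w‖ ≤ ‖w‖) (hΨy : Ψ y = (‖y‖ : 𝕜)) {δ : ℝ} (hδ : 0 < δ) :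
    ∃ w, ‖Q (y - w)‖ ≤ δ ∧ ‖w‖ ≤ RCLike.re (Ψ w) + δ ∧ ‖x‖ + ‖w‖ - δ ≤ ‖x + w‖ := by
  let φ : V →L[𝕜] 𝕜 := L1.integralCLM' 𝕜 ∘L Ψ.compLpL 1 ν ∘L S.toContinuousLinearMap
  have hφ (v : V) : φ v = ∫ s, Ψ (S v s) ∂ν := by
    refine (L1.integral_eq' 𝕜 _).symm.trans ((L1.integral_eq_integral _).trans ?_)
    exact Ψ.integral_compLp (S v)
  have hφy : φ y' = (‖y‖ : 𝕜) := by
    have hae : ∀ᵐ s ∂ν, Ψ (S y' s) = (‖y‖ : 𝕜) := by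
      filter_upwards [Lp.coeFn_const 1 ν y] with s hs
      rw [hy, hs, Function.const_apply, hΨy]
    rw [hφ, integral_congr_ae hae, integral_const, probReal_univ, one_smul]
  have norm_of_const {z : W} {z' : V} (hz : S z' = Lp.const 1 ν z) : ‖z'‖ = ‖z‖ := by
    rw [← S.norm_map, hz, Lp.norm_const' _ _ _ one_ne_zero ENNReal.one_ne_top, probReal_univ,
      Real.one_rpow, mul_one]
  obtain ⟨u, hu_norm, hTu, hφu, hxu⟩ := hT.isReplaceable φ y' x' (δ / 5) (by positivity)
  refine exists_slice_of_integral_le (S u) Q x y hΨ ?_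
  have hQu : ∫ s, ‖Q (y - S u s)‖ ∂ν ≤ δ / 5 := by
    refine (integral_congr_ae ?_).trans_le ((hQ (y' - u)).trans hTu)
    filter_upwards [Lp.coeFn_sub (S y') (S u), Lp.coeFn_const 1 ν y] with s hs hys
    rw [map_sub S, hs, Pi.sub_apply, hy, hys, Function.const_apply]
  have hre := (RCLike.re_le_norm (φ (y' - u))).trans hφu
  rw [map_sub φ, hφy, map_sub, RCLike.ofReal_re, hφ] at hre
  rw [norm_of_const hx, norm_of_const hy] at hxu
  rw [norm_of_const hy] at hre hu_norm
  rw [← hx, ← map_add S, S.norm_map, S.norm_map]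
  linarith

end RichSlices

section RichPeaks

variable {α 𝕜 E : Type*} {_ : MeasurableSpace α} {μ : Measure α} [RCLike 𝕜]
  [NormedAddCommGroup E] [NormedSpace 𝕜 E]

theorem exists_continuousLinearMap_eq_setIntegral (A : Set α) :
    ∃ Ψ : Lp 𝕜 1 μ →L[𝕜] 𝕜, ∀ f, Ψ f = ∫ t in A, f t ∂μ := by
  refine ⟨L1.integralCLM' 𝕜 ∘L LpToLpRestrictCLM α 𝕜 𝕜 μ 1 A, fun f => ?_⟩
  rw [ContinuousLinearMap.comp_apply, ← L1.integral_eq', L1.integral_eq_integral]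
  exact integral_congr_ae (LpToLpRestrictCLM_coeFn 𝕜 A f)

variable [IsFiniteMeasure μ]

theorem hasPeaks_of_norm_integral_le {T : Lp 𝕜 1 μ →L[𝕜] E} (hT : ∀ f, ‖∫ t, f t ∂μ‖ ≤ ‖T f‖)
    (h : ∀ (A : Set α) (hA : MeasurableSet A) (x : Lp 𝕜 1 μ) (δ : ℝ), 0 < δ → ∃ z : Lp 𝕜 1 μ,
      ‖T (indicatorConstLp 1 hA (measure_ne_top μ A) 1 - z)‖ ≤ δ ∧
        ‖z‖ ≤ RCLike.re (∫ t in A, z t ∂μ) + δ ∧ ‖x‖ + ‖z‖ - δ ≤ ‖x + z‖) : HasPeaks T := by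
  intro A hA x δ hδ
  obtain ⟨z, hTz, hz, hxz⟩ := h A hA x (δ / 3) (by positivity)
  have hz_int : Integrable z μ := L1.integrable_coeFn z
  have h_integral : ‖∫ t, z t ∂μ - μ.real A‖ ≤ δ / 3 := by
    rw [norm_sub_rev, ← integral_indicatorConstLp_one_sub hA (measure_ne_top μ A)]
    exact (hT _).trans hTz
  have hnorm : ‖z‖ = ∫ t in A, ‖z t‖ ∂μ + ∫ t in Aᶜ, ‖z t‖ ∂μ := by
    rw [integral_add_compl hA hz_int.norm, L1.norm_eq_integral_norm]
  have hsplit : RCLike.re (∫ t, z t ∂μ) =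
      RCLike.re (∫ t in A, z t ∂μ) + RCLike.re (∫ t in Aᶜ, z t ∂μ) := by
    rw [← integral_add_compl hA hz_int, map_add]
  have hre (B : Set α) : |RCLike.re (∫ t in B, z t ∂μ)| ≤ ∫ t in B, ‖z t‖ ∂μ :=
    (RCLike.abs_re_le_norm _).trans (norm_integral_le_integral_norm _)
  have hAre := (abs_le.1 (hre A)).2
  obtain ⟨hAcre, hAcre'⟩ := abs_le.1 (hre Aᶜ)
  have hintre : |RCLike.re (∫ t, z t ∂μ) - μ.real A| ≤ δ / 3 := by
    simpa using (RCLike.abs_re_le_norm _).trans h_integral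
  rw [abs_le] at hintre
  exact ⟨z, by linarith, by linarith, by linarith, by linarith, by linarith⟩

variable {V Y : Type*} [NormedAddCommGroup V] [NormedSpace 𝕜 V] {_ : MeasurableSpace Y}
  {ν : Measure Y} [IsProbabilityMeasure ν]

theorem IsRich.hasPeaks {L : Submodule 𝕜 V} [IsClosed (L : Set V)] (hL : IsRich L)
    (S : V →ₗᵢ[𝕜] Lp (Lp 𝕜 1 μ) 1 ν) (hconst : ∀ f, ∃ v, S v = Lp.const 1 ν f)
    {N : Submodule 𝕜 (Lp 𝕜 1 μ)} [IsClosed (N : Set (Lp 𝕜 1 μ))]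
    (hS : ∀ v ∈ L, ∀ᵐ s ∂ν, S v s ∈ N) (e : Lp 𝕜 1 μ ≃ₗᵢ[𝕜] Lp 𝕜 1 μ)
    (he : ∀ f ∈ N, ∫ t, e.symm f t ∂μ = 0) :
    HasPeaks (N.mkQL ∘L (e : Lp 𝕜 1 μ →L[𝕜] Lp 𝕜 1 μ)) := by
  choose Φ hΦ using fun A : Set α => exists_continuousLinearMap_eq_setIntegral (𝕜 := 𝕜) (μ := μ) A
  have norm_Φ_le (A : Set α) (f : Lp 𝕜 1 μ) : ‖Φ A (e.symm f)‖ ≤ ‖f‖ := by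
    rw [hΦ, ← e.symm.norm_map f, L1.norm_eq_integral_norm]
    exact (norm_integral_le_integral_norm _).trans
      (setIntegral_le_integral (L1.integrable_coeFn _).norm (.of_forall fun t => norm_nonneg _))
  refine hasPeaks_of_norm_integral_le (fun f => ?_) fun A hA x δ hδ => ?_
  · have h := norm_apply_le_norm_mkQL N
      (f := Φ Set.univ ∘L (e.symm : Lp 𝕜 1 μ →L[𝕜] Lp 𝕜 1 μ)) (norm_Φ_le _)
      (fun f hf => by simpa [hΦ] using he f hf) (e f)
    simpa [hΦ] using h
  · set y := indicatorConstLp 1 hA (measure_ne_top μ A) (1 : 𝕜)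
    obtain ⟨x', hx'⟩ := hconst (e x)
    obtain ⟨y', hy'⟩ := hconst (e y)
    have hΦy : Φ A (e.symm (e y)) = (‖e y‖ : 𝕜) := by
      rw [e.symm_apply_apply, e.norm_map, hΦ, norm_indicatorConstLp_one,
        setIntegral_congr_ae hA (indicatorConstLp_coeFn.mono fun t ht htA =>
          ht.trans (Set.indicator_of_mem htA _)), setIntegral_const, ← RCLike.ofReal_alg]
    obtain ⟨w, hQw, hΨw, hxw⟩ := hL.exists_slice S
      (integral_norm_mkQL_le_norm_mkQL S L N hS) hx' hy'
      (Ψ := Φ A ∘L (e.symm : Lp 𝕜 1 μ →L[𝕜] Lp 𝕜 1 μ)) (norm_Φ_le A) hΦy hδ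
    refine ⟨e.symm w, ?_, ?_, ?_⟩
    · simpa using hQw
    · simpa [hΦ] using hΨw
    · rw [← e.norm_map (x + e.symm w)]
      simpa using hxw

end RichPeaks

section CommonEigenvector

open Module.End

theorem exists_common_eigenvector {K E ι : Type*} [Field K] [IsAlgClosed K] [AddCommGroup E]
    [Module K E] [FiniteDimensional K E] [Nontrivial E] (U : ι → Module.End K E)
    (hU : ∀ i j, Commute (U i) (U j)) : ∃ v ≠ 0, ∀ i, ∃ c : K, U i v = c • v := by
  obtain ⟨W, ⟨hW, hinv⟩, hmin⟩ := wellFounded_lt.has_min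
    {W : Submodule K E | W ≠ ⊥ ∧ ∀ i, ∀ v ∈ W, U i v ∈ W} ⟨⊤, top_ne_bot, fun _ _ _ => trivial⟩
  obtain ⟨v, hv, hv0⟩ := W.ne_bot_iff.1 hW
  refine ⟨v, hv0, fun i => ?_⟩
  have : Nontrivial W := Submodule.nontrivial_iff_ne_bot.2 hW
  obtain ⟨c, hc⟩ := exists_eigenvalue ((U i).restrict (hinv i))
  obtain ⟨w, hw⟩ := hc.exists_hasEigenvector
  have hwc : U i w = c • (w : E) := congrArg Subtype.val hw.apply_eq_smul
  have hne : W ⊓ eigenspace (U i) c ≠ ⊥ := (Submodule.ne_bot_iff _).2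
    ⟨w, ⟨w.2, mem_eigenspace_iff.2 hwc⟩, fun h => hw.2 (Subtype.ext h)⟩
  have hle : W ≤ eigenspace (U i) c := by
    refine inf_eq_left.1 (eq_of_le_of_not_lt inf_le_left (hmin _ ⟨hne, fun j u hu => ?_⟩))
    exact ⟨hinv j u hu.1, mapsTo_genEigenspace_of_comm (hU i j) c 1 hu.2⟩
  exact ⟨c, mem_eigenspace_iff.1 (hle hv)⟩

theorem exists_common_eigenvector_of_isCompactOperator {H ι : Type*} [NormedAddCommGroup H]
    [InnerProductSpace ℂ H] [CompleteSpace H] {T : H →L[ℂ] H} (hT : IsCompactOperator T)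
    (hsymm : T.IsSymmetric) (hT0 : T ≠ 0) (U : ι → Module.End ℂ H)
    (hU : ∀ i j, Commute (U i) (U j)) (hTU : ∀ i, Commute (T : Module.End ℂ H) (U i)) :
    ∃ v ≠ 0, (∃ c : ℂ, c ≠ 0 ∧ T v = c • v) ∧ ∀ i, ∃ c : ℂ, U i v = c • v := by
  obtain ⟨c, hc, hc0⟩ : ∃ c, HasEigenvalue (T : Module.End ℂ H) c ∧ c ≠ 0 := by
    by_contra! h
    exact hT0 ((T.eq_zero_of_forall_hasEigenvalue_eq_zero hT hsymm).1 h)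
  have := T.finite_dimensional_eigenspace hT c hc0
  have : Nontrivial (eigenspace (T : Module.End ℂ H) c) := Submodule.nontrivial_iff_ne_bot.2 hc
  have hmaps i := mapsTo_genEigenspace_of_comm (hTU i) c 1
  obtain ⟨v, hv0, hv⟩ := exists_common_eigenvector (fun i => (U i).restrict (hmaps i))
    fun i j => LinearMap.ext fun v => Subtype.ext (LinearMap.congr_fun (hU i j) v.1)
  exact ⟨v, fun h => hv0 (Subtype.ext h), ⟨c, hc0, mem_eigenspace_iff.1 v.2⟩,
    fun i => (hv i).imp fun c hc => congrArg Subtype.val hc⟩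

theorem exists_common_eigenvector_mem_of_isCompactOperator {H ι : Type*} [NormedAddCommGroup H]
    [InnerProductSpace ℂ H] {T : H →L[ℂ] H} (hT : IsCompactOperator T) (hsymm : T.IsSymmetric)
    {U : ι → Module.End ℂ H} (hU : ∀ i j, Commute (U i) (U j))
    (hTU : ∀ i, Commute (T : Module.End ℂ H) (U i)) {N : Submodule ℂ H} [CompleteSpace N]
    (hTN : ∀ v ∈ N, T v ∈ N) (hUN : ∀ i, ∀ v ∈ N, U i v ∈ N) {f : H} (hf : f ∈ N)
    (hTf : T f ≠ 0) :
    ∃ v ∈ N, v ≠ 0 ∧ (∃ c : ℂ, c ≠ 0 ∧ T v = c • v) ∧ ∀ i, ∃ c : ℂ, U i v = c • v := by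
  have hT0 : T.restrict hTN ≠ 0 := fun h => hTf <| by
    have hf0 : T.restrict hTN ⟨f, hf⟩ = 0 := by rw [h, zero_apply]
    exact congrArg Subtype.val hf0
  obtain ⟨v, hv0, ⟨c, hc0, hc⟩, hv⟩ := exists_common_eigenvector_of_isCompactOperator
    (hT.restrict' hTN) (hsymm.restrict_invariant hTN) hT0 (fun i => (U i).restrict (hUN i))
    (fun i j => LinearMap.ext fun v => Subtype.ext (LinearMap.congr_fun (hU i j) v.1))
    fun i => LinearMap.ext fun v => Subtype.ext (LinearMap.congr_fun (hTU i) v.1)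
  exact ⟨v, v.2, fun h => hv0 (Subtype.ext h), ⟨c, hc0, congrArg Subtype.val hc⟩,
    fun i => (hv i).imp fun d hd => congrArg Subtype.val hd⟩

end CommonEigenvector

noncomputable section DualFamily

variable {𝕜 X E : Type*} [RCLike 𝕜] [TopologicalSpace X] [CompactSpace X] [NormedAddCommGroup E]
  [NormedSpace 𝕜 E]

/-- The operator `v ↦ (x ↦ U x v)` defined by a continuous family `U` of functionals. Integral
operators with a continuous kernel are of this form. -/
def dualFamilyL (U : C(X, StrongDual 𝕜 E)) : E →L[𝕜] C(X, 𝕜) :=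
  LinearMap.mkContinuous
    { toFun := fun v => ⟨fun x => U x v, by fun_prop⟩
      map_add' := fun v w => ContinuousMap.ext fun x => map_add (U x) v w
      map_smul' := fun c v => ContinuousMap.ext fun x => map_smul (U x) c v } ‖U‖ fun v =>
    (ContinuousMap.norm_le _ (by positivity)).2 fun x =>
      (U x).le_of_opNorm_le (U.norm_coe_le_norm x) v

theorem isCompactOperator_dualFamilyL (U : C(X, StrongDual 𝕜 E)) :
    IsCompactOperator (dualFamilyL U) := by
  let e : C(X, 𝕜) ≃ᵢ BoundedContinuousFunction X 𝕜 :=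
    ContinuousMap.isometryEquivBoundedOfCompact X 𝕜
  set S : Set C(X, 𝕜) := dualFamilyL U '' Metric.closedBall 0 1
  have hS : IsCompact (closure (e '' S)) := by
    refine BoundedContinuousFunction.arzela_ascoli (Metric.closedBall 0 ‖U‖)
      (isCompact_closedBall _ _) _ ?_ fun x₀ => ?_
    · rintro _ x ⟨_, ⟨v, hv, rfl⟩, rfl⟩
      rw [mem_closedBall_zero_iff] at hv ⊢
      exact (U x).le_of_opNorm_le_of_le (U.norm_coe_le_norm x) hv |>.trans_eq (mul_one _)
    · refine Metric.equicontinuousAt_of_continuity_modulus (fun x => ‖U x₀ - U x‖) ?_ _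
        (.of_forall ?_)
      · have hcont : Continuous fun x => ‖U x₀ - U x‖ := by fun_prop
        simpa using hcont.tendsto x₀
      · rintro x ⟨_, ⟨_, ⟨v, hv, rfl⟩, rfl⟩⟩
        rw [mem_closedBall_zero_iff] at hv
        exact (dist_eq_norm (U x₀ v) (U x v)).trans_le
          ((U x₀ - U x).le_of_opNorm_le_of_le le_rfl hv |>.trans_eq (mul_one _))
  refine ⟨e ⁻¹' closure (e '' S), e.toHomeomorph.isClosedEmbedding.isCompact_preimage hS, ?_⟩
  filter_upwards [Metric.closedBall_mem_nhds (0 : E) one_pos] with v hv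
  exact subset_closure ⟨_, ⟨v, hv, rfl⟩, rfl⟩

end DualFamily

noncomputable section HilbertSchmidt

variable {X Y : Type*} [TopologicalSpace X] [CompactSpace X] [TopologicalSpace Y] [CompactSpace Y]
  [MeasurableSpace Y] [BorelSpace Y] (ν : Measure Y) [IsFiniteMeasure ν]

/-- The integral operator `f ↦ (x ↦ ∫ F (x, y) f y)` with a continuous kernel `F`, from `L²` to
continuous functions. -/
def integralOp (F : C(X × Y, ℂ)) : Lp ℂ 2 ν →L[ℂ] C(X, ℂ) :=
  dualFamilyL ⟨fun x => innerSL ℂ (ContinuousMap.toLp 2 ν ℂ (star (F.curry x))), by fun_prop⟩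

theorem integralOp_apply (F : C(X × Y, ℂ)) (f : Lp ℂ 2 ν) (x : X) :
    integralOp ν F f x = inner ℂ (ContinuousMap.toLp 2 ν ℂ (star (F.curry x))) f := rfl

theorem integralOp_toLp_apply (F : C(X × Y, ℂ)) (f : C(Y, ℂ)) (x : X) :
    integralOp ν F (ContinuousMap.toLp 2 ν ℂ f) x = ∫ y, F (x, y) * f y ∂ν := by
  rw [integralOp_apply, ContinuousMap.inner_toLp]
  simp only [ContinuousMap.star_apply, RCLike.star_def, Complex.conj_conj,
    ContinuousMap.curry_apply, mul_comm]

theorem isSymmetric_toLp_comp_integralOp [T2Space Y] [ν.WeaklyRegular] {F : C(Y × Y, ℂ)}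
    (hF : ∀ x y, F (y, x) = conj (F (x, y))) :
    (ContinuousMap.toLp 2 ν ℂ ∘L integralOp ν F).IsSymmetric := by
  have hdense := ContinuousMap.toLp_denseRange (p := 2) ℂ ν ℂ ENNReal.ofNat_ne_top
  intro f g
  refine hdense.induction_on₂ (p := fun f g => inner ℂ (ContinuousMap.toLp 2 ν ℂ (integralOp ν F f))
    g = inner ℂ f (ContinuousMap.toLp 2 ν ℂ (integralOp ν F g)))
    (isClosed_eq (by fun_prop) (by fun_prop)) (fun u v => ?_) f g
  rw [ContinuousMap.inner_toLp, ContinuousMap.inner_toLp]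
  calc ∫ x, v x * conj (integralOp ν F (ContinuousMap.toLp 2 ν ℂ u) x) ∂ν
      = ∫ x, ∫ y, v x * (F (y, x) * conj (u y)) ∂ν ∂ν := by
        simp only [integralOp_toLp_apply, ← integral_conj, map_mul, ← hF, integral_const_mul]
    _ = ∫ y, ∫ x, v x * (F (y, x) * conj (u y)) ∂ν ∂ν :=
        integral_integral_swap_of_hasCompactSupport (by fun_prop) (.of_compactSpace _)
    _ = ∫ y, integralOp ν F (ContinuousMap.toLp 2 ν ℂ v) y * conj (u y) ∂ν := by
        simp only [integralOp_toLp_apply, ← integral_mul_const]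
        congr! 4
        ring

end HilbertSchmidt

noncomputable section Characters

variable {G : Type*} [CommGroup G] [TopologicalSpace G]

/-- A character, regarded as a complex-valued continuous function. -/
def characterMap (χ : PontryaginDual G) : C(G, ℂ) :=
  ⟨fun x => (χ x : ℂ), continuous_subtype_val.comp (map_continuous χ)⟩

theorem characterMap_apply (χ : PontryaginDual G) (x : G) : characterMap χ x = (χ x : ℂ) := rfl

theorem characterMap_mul_apply (χ : PontryaginDual G) (s x : G) :
    characterMap χ (s * x) = characterMap χ s * characterMap χ x :=
  congrArg ((↑) : Circle → ℂ) (map_mul χ s x)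

theorem norm_eq_one_of_forall_mul [CompactSpace G] {v : C(G, ℂ)} {c : G → ℂ} (hv : v ≠ 0)
    (h : ∀ s x, v (s * x) = c s * v x) (s : G) : ‖c s‖ = 1 := by
  have hnorm (t : G) : ‖c t‖ ≤ 1 := by
    refine le_of_mul_le_mul_right ?_ (norm_pos_iff.2 hv)
    rw [one_mul, ← norm_smul, ContinuousMap.norm_le _ (norm_nonneg v)]
    exact fun x => (congrArg norm (h t x)).symm.trans_le (v.norm_coe_le_norm (t * x))
  obtain ⟨x, hx⟩ := DFunLike.ne_iff.1 hv
  have hinv : c s * c s⁻¹ = 1 := by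
    refine mul_right_cancel₀ hx ?_
    rw [mul_assoc, ← h, ← h, mul_inv_cancel_left, one_mul]
  have hinv' : ‖c s‖ * ‖c s⁻¹‖ = 1 := by rw [← norm_mul, hinv, norm_one]
  nlinarith [hnorm s, hnorm s⁻¹, norm_nonneg (c s)]

theorem exists_eq_smul_characterMap [CompactSpace G] {v : C(G, ℂ)} (hv : v ≠ 0)
    (h : ∀ s, ∃ c : ℂ, ∀ x, v (s * x) = c * v x) :
    ∃ (χ : PontryaginDual G) (d : ℂ), v = d • characterMap χ := by
  choose c hc using h
  have hone (s : G) : v s = c s * v 1 := by simpa using hc s 1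
  have hv1 : v 1 ≠ 0 := fun h1 => hv (ContinuousMap.ext fun s => by simp [hone s, h1])
  have hcv : c = fun s => v s / v 1 := funext fun s => by rw [hone s, mul_div_cancel_right₀ _ hv1]
  let χ : G →ₜ* Circle :=
    { toFun := fun s => ⟨c s, mem_sphere_zero_iff_norm.2 (norm_eq_one_of_forall_mul hv hc s)⟩
      map_one' := Circle.ext (by simp [hcv, hv1])
      map_mul' := fun s t => Circle.ext (by
        change c (s * t) = c s * c t
        simp only [hcv, hc s t]
        field_simp)
      continuous_toFun := Continuous.subtype_mk (by rw [hcv]; fun_prop) _ }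
  exact ⟨χ, v 1, ContinuousMap.ext fun s => (hone s).trans (mul_comm _ _)⟩

variable [IsTopologicalGroup G] [MeasurableSpace G] [BorelSpace G] (μ : Measure G)

/-- The translation `f ↦ (x ↦ f (s * x))` of `L²` functions. -/
def translateL2 [μ.IsMulLeftInvariant] (s : G) : Lp ℂ 2 μ →ₗᵢ[ℂ] Lp ℂ 2 μ :=
  Lp.compMeasurePreservingₗᵢ ℂ (s * ·) (measurePreserving_mul_left μ s)

theorem translateL2_comm [μ.IsMulLeftInvariant] (s t : G) (f : Lp ℂ 2 μ) :
    translateL2 μ s (translateL2 μ t f) = translateL2 μ t (translateL2 μ s f) :=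
  smul_comm (DomMulAct.mk s) (DomMulAct.mk t) f

variable [CompactSpace G] [IsFiniteMeasure μ]

/-- Convolution with `k`, from `L²` to continuous functions. -/
def convolutionL (k : C(G, ℂ)) : Lp ℂ 2 μ →L[ℂ] C(G, ℂ) :=
  integralOp μ ⟨fun p => k (p.1 * p.2⁻¹), by fun_prop⟩

theorem isSymmetric_toLp_comp_convolutionL [T2Space G] [μ.WeaklyRegular] {k : C(G, ℂ)}
    (hk : ∀ x, k x⁻¹ = conj (k x)) : (ContinuousMap.toLp 2 μ ℂ ∘L convolutionL μ k).IsSymmetric :=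
  isSymmetric_toLp_comp_integralOp μ fun x y => by
    rw [ContinuousMap.coe_mk, ← hk, mul_inv_rev, inv_inv]

variable [μ.IsMulLeftInvariant]

theorem translateL2_toLp (s : G) (f : C(G, ℂ)) : translateL2 μ s (ContinuousMap.toLp 2 μ ℂ f) =
    ContinuousMap.toLp 2 μ ℂ (f.comp (.mulLeft s)) := rfl

theorem translateL2_characterMap (s : G) (χ : PontryaginDual G) :
    translateL2 μ s (ContinuousMap.toLp 2 μ ℂ (characterMap χ)) =
      characterMap χ s • ContinuousMap.toLp 2 μ ℂ (characterMap χ) := by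
  rw [translateL2_toLp, ← map_smul]
  exact congrArg _ (ContinuousMap.ext (characterMap_mul_apply χ s))

theorem convolutionL_translateL2 (k : C(G, ℂ)) (s : G) (f : Lp ℂ 2 μ) :
    convolutionL μ k (translateL2 μ s f) = (convolutionL μ k f).comp (.mulLeft s) := by
  ext x
  rw [convolutionL, integralOp_apply, ContinuousMap.comp_apply, integralOp_apply]
  refine Eq.trans ?_ ((translateL2 μ s).inner_map_map _ f)
  rw [translateL2_toLp]
  congr 2
  ext y
  change conj (k (x * y⁻¹)) = conj (k (s * x * (s * y)⁻¹))
  rw [mul_inv, mul_mul_mul_comm, mul_inv_cancel, one_mul]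

theorem convolutionL_characterMap (k : C(G, ℂ)) (χ : PontryaginDual G) :
    convolutionL μ k (ContinuousMap.toLp 2 μ ℂ (characterMap χ)) =
      convolutionL μ k (ContinuousMap.toLp 2 μ ℂ (characterMap χ)) 1 • characterMap χ := by
  ext s
  have h := congrArg (· 1)
    (convolutionL_translateL2 μ k s (ContinuousMap.toLp 2 μ ℂ (characterMap χ)))
  rw [translateL2_characterMap, map_smul] at h
  simpa [mul_comm] using h.symm

end Characters

noncomputable section PeterWeyl

variable {G : Type*} [CommGroup G] [TopologicalSpace G] [CompactSpace G] [MeasurableSpace G]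
  [BorelSpace G] (μ : Measure G)

/-- The `L²` functions orthogonal to all characters. -/
def charactersOrthogonal [IsFiniteMeasure μ] : Submodule ℂ (Lp ℂ 2 μ) :=
  (Submodule.span ℂ (Set.range fun χ => ContinuousMap.toLp 2 μ ℂ (characterMap (G := G) χ)))ᗮ

theorem mem_charactersOrthogonal [IsFiniteMeasure μ] {f : Lp ℂ 2 μ} :
    f ∈ charactersOrthogonal μ ↔
      ∀ χ, inner ℂ (ContinuousMap.toLp 2 μ ℂ (characterMap χ)) f = 0 := by
  have hspan : (∀ χ, inner ℂ (ContinuousMap.toLp 2 μ ℂ (characterMap χ)) f = 0) ↔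
      Submodule.span ℂ (Set.range fun χ => ContinuousMap.toLp 2 μ ℂ (characterMap χ)) ≤
        (ℂ ∙ f)ᗮ := by
    simp only [Submodule.span_le, Set.range_subset_iff, SetLike.mem_coe,
      Submodule.mem_orthogonal_singleton_iff_inner_left]
  rw [hspan]
  exact forall₂_congr fun u _ => Submodule.mem_orthogonal_singleton_iff_inner_left.symm

variable [IsTopologicalGroup G]

theorem isCompactOperator_toLp_comp_convolutionL [IsFiniteMeasure μ] (k : C(G, ℂ)) :
    IsCompactOperator (ContinuousMap.toLp 2 μ ℂ ∘L convolutionL μ k) :=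
  have hk : IsCompactOperator (convolutionL μ k) := isCompactOperator_dualFamilyL _
  hk.clm_comp (ContinuousMap.toLp 2 μ ℂ : C(G, ℂ) →L[ℂ] Lp ℂ 2 μ)

variable [μ.IsHaarMeasure]

theorem translateL2_mem_charactersOrthogonal {f : Lp ℂ 2 μ} (hf : f ∈ charactersOrthogonal μ)
    (s : G) : translateL2 μ s f ∈ charactersOrthogonal μ := by
  rw [mem_charactersOrthogonal] at hf ⊢
  intro χ
  have h := (translateL2 μ s).inner_map_map (ContinuousMap.toLp 2 μ ℂ (characterMap χ)) f
  rw [hf χ, translateL2_characterMap, inner_smul_left, mul_eq_zero] at h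
  exact h.resolve_left (by simp [characterMap_apply])

variable [T2Space G] [μ.WeaklyRegular]

theorem convolutionL_mem_charactersOrthogonal {k : C(G, ℂ)} (hk : ∀ x, k x⁻¹ = conj (k x))
    {f : Lp ℂ 2 μ} (hf : f ∈ charactersOrthogonal μ) :
    ContinuousMap.toLp 2 μ ℂ (convolutionL μ k f) ∈ charactersOrthogonal μ := by
  rw [mem_charactersOrthogonal] at hf ⊢
  intro χ
  have h := isSymmetric_toLp_comp_convolutionL μ hk (ContinuousMap.toLp 2 μ ℂ (characterMap χ)) f
  refine h.symm.trans ?_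
  change inner ℂ (ContinuousMap.toLp 2 μ ℂ (convolutionL μ k _)) f = 0
  rw [convolutionL_characterMap, map_smul, inner_smul_left, hf χ, mul_zero]

theorem exists_convolutionL_eigenvector {k : C(G, ℂ)} (hk : ∀ x, k x⁻¹ = conj (k x))
    {f : Lp ℂ 2 μ} (hf : f ∈ charactersOrthogonal μ) (hkf : convolutionL μ k f ≠ 0) :
    ∃ v ∈ charactersOrthogonal μ, v ≠ 0 ∧
      (∃ c : ℂ, c ≠ 0 ∧ ContinuousMap.toLp 2 μ ℂ (convolutionL μ k v) = c • v) ∧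
      ∀ s, ∃ c : ℂ, translateL2 μ s v = c • v := by
  have hclosed : IsClosed (charactersOrthogonal μ : Set (Lp ℂ 2 μ)) :=
    Submodule.isClosed_orthogonal _
  have : CompleteSpace (charactersOrthogonal μ) := hclosed.completeSpace_coe
  refine exists_common_eigenvector_mem_of_isCompactOperator
    (isCompactOperator_toLp_comp_convolutionL μ k) (isSymmetric_toLp_comp_convolutionL μ hk)
    (U := fun s => (translateL2 μ s).toLinearMap)
    (fun s t => LinearMap.ext fun v => translateL2_comm μ s t v)
    (fun s => LinearMap.ext fun v =>
      congrArg (ContinuousMap.toLp 2 μ ℂ) (convolutionL_translateL2 μ k s v))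
    (fun v => convolutionL_mem_charactersOrthogonal μ hk)
    (fun s v hv => translateL2_mem_charactersOrthogonal μ hv s) hf fun h => hkf ?_
  exact ContinuousMap.toLp_injective (p := 2) (𝕜 := ℂ) μ (h.trans (map_zero _).symm)

theorem convolutionL_eq_zero_of_mem_charactersOrthogonal {k : C(G, ℂ)}
    (hk : ∀ x, k x⁻¹ = conj (k x)) {f : Lp ℂ 2 μ} (hf : f ∈ charactersOrthogonal μ) :
    convolutionL μ k f = 0 := by
  by_contra hkf
  obtain ⟨v, hv, hv0, ⟨c, hc0, hc⟩, hvs⟩ := exists_convolutionL_eigenvector μ hk hf hkf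
  set w := convolutionL μ k v with hw
  have hw0 : w ≠ 0 := fun h => smul_ne_zero hc0 hv0 (by rw [← hc, h, map_zero])
  obtain ⟨χ, d, hd⟩ := exists_eq_smul_characterMap hw0 fun s => by
    obtain ⟨b, hb⟩ := hvs s
    have h : w.comp (.mulLeft s) = b • w := by rw [hw, ← convolutionL_translateL2, hb, map_smul]
    exact ⟨b, fun x => DFunLike.congr_fun h x⟩
  have horth : inner ℂ (c • v) v = 0 := by
    rw [← hc, hd, map_smul, inner_smul_left, (mem_charactersOrthogonal μ).1 hv χ, mul_zero]
  rw [inner_smul_left, mul_eq_zero, inner_self_eq_zero] at horth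
  exact horth.elim (by simpa using hc0) hv0

theorem charactersOrthogonal_eq_bot : charactersOrthogonal μ = ⊥ := by
  refine (Submodule.eq_bot_iff _).2 fun f hf => ?_
  have hherm (k : C(G, ℂ)) (hk : ∀ x, k x⁻¹ = conj (k x)) :
      inner ℂ (ContinuousMap.toLp 2 μ ℂ k) f = 0 := by
    have h := DFunLike.congr_fun (convolutionL_eq_zero_of_mem_charactersOrthogonal μ hk hf) 1
    rw [convolutionL, integralOp_apply, ContinuousMap.zero_apply] at h
    convert h using 3
    ext y
    change k y = conj (k (1 * y⁻¹))
    rw [one_mul, hk, Complex.conj_conj]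
  refine (ContinuousMap.toLp_denseRange (p := 2) ℂ μ ℂ ENNReal.ofNat_ne_top).eq_zero_of_inner_right
    ℂ fun g => ?_
  let g' : C(G, ℂ) := ⟨fun x => conj (g x⁻¹), by fun_prop⟩
  have hadd := hherm (g + g') fun x => by simp [g', add_comm]
  have hsub := hherm (Complex.I • (g - g')) fun x => by simp [g']; ring
  rw [map_add, inner_add_left] at hadd
  rw [map_smul, map_sub, inner_smul_left, inner_sub_left, mul_eq_zero] at hsub
  have hsub' := hsub.resolve_left (by simp)
  linear_combination (hadd + hsub') / 2

end PeterWeyl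

section Separation

variable {G : Type*} [CommGroup G] [TopologicalSpace G] [IsTopologicalGroup G] [CompactSpace G]
  [T2Space G]

theorem comp_mulLeft_eq_of_forall_character_eq_one {s : G} (hs : ∀ χ : PontryaginDual G, χ s = 1)
    (g : C(G, ℂ)) : g.comp (.mulLeft s) = g := by
  let : MeasurableSpace G := borel G
  have : BorelSpace G := ⟨rfl⟩
  let μ : Measure G := Measure.haarMeasure ⊤
  have hmem : translateL2 μ s (ContinuousMap.toLp 2 μ ℂ g) - ContinuousMap.toLp 2 μ ℂ g ∈
      charactersOrthogonal μ := by
    refine (mem_charactersOrthogonal μ).2 fun χ => ?_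
    have h := (translateL2 μ s).inner_map_map (ContinuousMap.toLp 2 μ ℂ (characterMap χ))
      (ContinuousMap.toLp 2 μ ℂ g)
    rw [translateL2_characterMap, characterMap_apply, hs χ, Circle.coe_one, one_smul] at h
    rw [inner_sub_right, h, sub_self]
  rw [charactersOrthogonal_eq_bot, Submodule.mem_bot, sub_eq_zero, translateL2_toLp] at hmem
  exact ContinuousMap.toLp_injective (p := 2) (𝕜 := ℂ) μ hmem

theorem exists_character_ne_one {s : G} (hs : s ≠ 1) : ∃ χ : PontryaginDual G, χ s ≠ 1 := by
  by_contra! h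
  obtain ⟨g, hg0, hg1, -⟩ := exists_continuous_zero_one_of_isClosed
    (isClosed_singleton (x := (1 : G))) (isClosed_singleton (x := s))
    (Set.disjoint_singleton.2 hs.symm)
  have hg := DFunLike.congr_fun
    (comp_mulLeft_eq_of_forall_character_eq_one h ⟨fun x => (g x : ℂ), by fun_prop⟩) 1
  simp [hg0 (Set.mem_singleton 1), hg1 (Set.mem_singleton s)] at hg

theorem span_characterMap_topologicalClosure_eq_top :
    (Submodule.span ℂ (Set.range (characterMap (G := G)))).topologicalClosure = ⊤ := by
  let A : StarSubalgebra ℂ C(G, ℂ) :=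
    { toSubalgebra := Algebra.adjoin ℂ (Set.range characterMap)
      star_mem' := by
        change Algebra.adjoin ℂ (Set.range characterMap) ≤
          star (Algebra.adjoin ℂ (Set.range characterMap))
        refine Algebra.adjoin_le ?_
        rintro - ⟨χ, rfl⟩
        exact Algebra.subset_adjoin
          ⟨χ⁻¹, ContinuousMap.ext fun x => Circle.coe_inv_eq_conj (χ x)⟩ }
  have hA : Subalgebra.toSubmodule A.toSubalgebra =
      Submodule.span ℂ (Set.range (characterMap (G := G))) := by
    refine Algebra.adjoin_eq_span_of_subset ℂ (Set.Subset.trans ?_ Submodule.subset_span)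
    refine fun v hv => Submonoid.closure_induction (fun _ => id) ⟨1, rfl⟩ ?_ hv
    rintro - - - - ⟨χ, rfl⟩ ⟨ψ, rfl⟩
    exact ⟨χ * ψ, rfl⟩
  have hsep : A.SeparatesPoints := by
    intro x y hxy
    obtain ⟨χ, hχ⟩ := exists_character_ne_one (mt div_eq_one.1 hxy)
    refine ⟨_, ⟨characterMap χ, Algebra.subset_adjoin ⟨χ, rfl⟩, rfl⟩, fun h => hχ ?_⟩
    rw [map_div, div_eq_one]
    exact Circle.ext h
  rw [← hA]
  exact congrArg (Subalgebra.toSubmodule <| StarSubalgebra.toSubalgebra ·)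
    (ContinuousMap.starSubalgebra_topologicalClosure_eq_top_of_separatesPoints A hsep)

end Separation

section Uniqueness

open Function

variable {X : Type*} [TopologicalSpace X] [CompactSpace X] [T2Space X] [MeasurableSpace X]
  [BorelSpace X] {μ : Measure X} [IsFiniteMeasure μ] [μ.OuterRegular]

theorem exists_continuousMap_eqOn_one_measure_support_sdiff_lt {K : Set X} (hK : IsClosed K)
    {δ : ENNReal} (hδ : δ ≠ 0) :
    ∃ k : C(X, ℂ), Set.EqOn k 1 K ∧ (∀ x, ‖k x‖ ≤ 1) ∧ μ (support k \ K) < δ := by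
  obtain ⟨U, hKU, hU, hUδ⟩ := K.exists_isOpen_lt_add (measure_ne_top μ K) hδ
  obtain ⟨k, hkU, hkK, hk⟩ := exists_continuous_zero_one_of_isClosed hU.isClosed_compl hK
    (Set.disjoint_compl_left_iff_subset.2 hKU)
  refine ⟨⟨fun x => (k x : ℂ), by fun_prop⟩, fun x hx => by simp [hkK hx],
    fun x => by simpa [abs_of_nonneg (hk x).1] using (hk x).2, ?_⟩
  have hsupp : support (fun x => (k x : ℂ)) ⊆ U := fun x hx => by
    by_contra hxU
    exact hx (by simp [hkU hxU])
  refine (measure_mono (Set.sdiff_subset_sdiff_left hsupp)).trans_lt ?_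
  rw [measure_sdiff hKU hK.nullMeasurableSet (measure_ne_top μ K)]
  exact ENNReal.sub_lt_of_lt_add (measure_mono hKU) (by rwa [add_comm])

theorem ae_eq_zero_of_forall_integral_continuousMap_smul_eq_zero {E : Type*}
    [NormedAddCommGroup E] [NormedSpace ℂ E] [CompleteSpace E] {f : X → E} (hf : Integrable f μ)
    (h : ∀ k : C(X, ℂ), ∫ x, k x • f x ∂μ = 0) : f =ᵐ[μ] 0 := by
  refine ae_eq_zero_of_forall_setIntegral_isClosed_eq_zero hf fun K hK => ?_
  refine norm_le_zero_iff.1 (le_of_forall_pos_le_add fun ε hε => ?_)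
  obtain ⟨δ, hδ, hδε⟩ := exists_pos_setLIntegral_lt_of_measure_lt hf.2.ne
    (ENNReal.ofReal_pos.2 hε).ne'
  obtain ⟨k, hkK, hk, hkδ⟩ :=
    exists_continuousMap_eqOn_one_measure_support_sdiff_lt (μ := μ) hK hδ.ne'
  have hbound (x : X) : ‖K.indicator f x - k x • f x‖ ≤ (support k \ K).indicator (‖f ·‖) x := by
    by_cases hxK : x ∈ K
    · simp [hxK, hkK hxK]
    by_cases hxk : k x = 0
    · simp [hxK, hxk]
    · simpa [hxK, hxk, norm_smul] using mul_le_of_le_one_left (norm_nonneg (f x)) (hk x)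
  have hkf : Integrable (fun x => k x • f x) μ := hf.bdd_smul 1 (by fun_prop) (.of_forall hk)
  have hmeas : MeasurableSet (support k \ K) :=
    (isOpen_ne_fun k.continuous continuous_const).measurableSet.diff hK.measurableSet
  rw [zero_add]
  calc ‖∫ x in K, f x ∂μ‖ = ‖∫ x, (K.indicator f x - k x • f x) ∂μ‖ := by
        rw [integral_sub (hf.indicator hK.measurableSet) hkf, h k, sub_zero,
          integral_indicator hK.measurableSet]
    _ ≤ ∫ x, (support k \ K).indicator (‖f ·‖) x ∂μ :=
        norm_integral_le_of_norm_le (hf.norm.indicator hmeas) (.of_forall hbound)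
    _ = (∫⁻ x in support k \ K, ‖f x‖ₑ ∂μ).toReal := by
        rw [integral_indicator hmeas, integral_norm_eq_lintegral_enorm hf.1.restrict]
    _ ≤ ε := ENNReal.toReal_le_of_le_ofReal hε.le (hδε _ hkδ).le

variable {G E : Type*} [CommGroup G] [TopologicalSpace G] [IsTopologicalGroup G] [CompactSpace G]
  [T2Space G] [MeasurableSpace G] [BorelSpace G] [NormedAddCommGroup E] [NormedSpace ℂ E]
  [CompleteSpace E] {ν : Measure G} [IsFiniteMeasure ν] [ν.OuterRegular]

theorem eq_zero_of_forall_integralSMulL_characterMap_eq_zero {f : Lp E 1 ν}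
    (h : ∀ χ, integralSMulL ν (characterMap χ) f = 0) : f = 0 := by
  have hker : Submodule.span ℂ (Set.range characterMap) ≤
      LinearMap.ker ((integralSMulL (E := E) ν).flip f).toLinearMap :=
    Submodule.span_le.2 (Set.range_subset_iff.2 h)
  have htop := Submodule.topologicalClosure_minimal _ hker
    ((integralSMulL (E := E) ν).flip f).isClosed_ker
  rw [span_characterMap_topologicalClosure_eq_top] at htop
  refine (Lp.eq_zero_iff_ae_eq_zero).2 <| ae_eq_zero_of_forall_integral_continuousMap_smul_eq_zero
    (L1.integrable_coeFn f) fun k => ?_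
  rw [← integralSMulL_apply]
  exact htop (Submodule.mem_top (x := k))

theorem ae_mem_of_forall_integralSMulL_characterMap_mem {N : Submodule ℂ E}
    [IsClosed (N : Set E)] {f : Lp E 1 ν} (h : ∀ χ, integralSMulL ν (characterMap χ) f ∈ N) :
    ∀ᵐ y ∂ν, f y ∈ N := by
  have hcoe := N.mkQL.coeFn_compLp f
  have hzero : N.mkQL.compLp f = 0 := eq_zero_of_forall_integralSMulL_characterMap_eq_zero fun χ =>
    calc integralSMulL ν (characterMap χ) (N.mkQL.compLp f)
        = N.mkQL (integralSMulL ν (characterMap χ) f) := by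
          rw [apply_integralSMulL, integralSMulL_apply]
          exact integral_congr_ae (hcoe.mono fun y hy => congrArg (characterMap χ y • ·) hy)
      _ = 0 := (Submodule.Quotient.mk_eq_zero N).2 (h χ)
  rw [hzero] at hcoe
  filter_upwards [hcoe, Lp.coeFn_zero (E ⧸ N) 1 ν] with y hy hy0
  exact (Submodule.Quotient.mk_eq_zero N).1 (hy.symm.trans hy0)

end Uniqueness

section Haar

variable {G₁ G₂ : Type*} [CommGroup G₁] [TopologicalSpace G₁] [IsTopologicalGroup G₁]
  [CompactSpace G₁] [MeasurableSpace G₁] [BorelSpace G₁] (μ : Measure G₁) [μ.IsHaarMeasure]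

theorem nullSingletonClass_of_infinite [T1Space G₁] [Infinite G₁] : NullSingletonClass μ := by
  have : (nhdsWithin (1 : G₁) {1}ᶜ).NeBot := by
    rw [← not_not (a := Filter.NeBot _), Filter.not_neBot, ← isOpen_singleton_iff_punctured_nhds]
    intro h
    have := discreteTopology_of_isOpen_singleton_one h
    exact not_finite_iff_infinite.2 ‹_› (finite_of_compact_of_discrete (X := G₁))
  infer_instance

variable [IsProbabilityMeasure μ] [CommGroup G₂] [TopologicalSpace G₂] [IsTopologicalGroup G₂]
  [CompactSpace G₂] [MeasurableSpace (G₁ × G₂)] [BorelSpace (G₁ × G₂)] (ρ : Measure (G₁ × G₂))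
  [IsProbabilityMeasure ρ] [ρ.IsHaarMeasure]

theorem measurePreserving_fst_of_isHaarMeasure : MeasurePreserving Prod.fst ρ μ := by
  have hfst : Measurable (Prod.fst : G₁ × G₂ → G₁) := continuous_fst.measurable
  have : (ρ.map Prod.fst).IsHaarMeasure := Measure.isHaarMeasure_map ρ (MonoidHom.fst G₁ G₂)
    continuous_fst Prod.fst_surjective (by simp)
  have : IsProbabilityMeasure (ρ.map Prod.fst) :=
    Measure.isProbabilityMeasure_map hfst.aemeasurable
  exact ⟨hfst, Measure.isHaarMeasure_eq_of_isProbabilityMeasure _ _⟩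

theorem isProductIntegral_of_isHaarMeasure [MeasurableSpace G₂] [BorelSpace G₂] (ν : Measure G₂)
    [IsProbabilityMeasure ν] [ν.IsHaarMeasure] : IsProductIntegral μ ν ρ := by
  intro F
  have hswap (y : G₂) : ∫ x, ∫ p, F (x * p.1, y * p.2) ∂ρ ∂μ =
      ∫ p, ∫ x, F (x * p.1, y * p.2) ∂μ ∂ρ :=
    integral_integral_swap_of_hasCompactSupport (f := fun x (p : G₁ × G₂) => F (x * p.1, y * p.2))
      (by unfold Function.uncurry; fun_prop) (.of_compactSpace _)
  have hcont : Continuous fun q : G₂ × G₁ × G₂ => ∫ x, F (x, q.1 * q.2.2) ∂μ :=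
    continuousOn_univ.1 <| continuousOn_integral_of_compact_support isCompact_univ
      (by unfold Function.uncurry; fun_prop) fun _ x _ hx => absurd (Set.mem_univ x) hx
  calc ∫ p, F p ∂ρ = ∫ y, ∫ x, ∫ p, F (x * p.1, y * p.2) ∂ρ ∂μ ∂ν := by
        have hinv (x : G₁) (y : G₂) : ∫ p, F (x * p.1, y * p.2) ∂ρ = ∫ p, F p ∂ρ :=
          integral_mul_left_eq_self (fun p => F p) ((x, y) : G₁ × G₂)
        simp [hinv]
    _ = ∫ y, ∫ p : G₁ × G₂, ∫ x, F (x, y * p.2) ∂μ ∂ρ ∂ν := by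
        have hinv (y : G₂) (p : G₁ × G₂) :
            ∫ x, F (x * p.1, y * p.2) ∂μ = ∫ x, F (x, y * p.2) ∂μ :=
          integral_mul_right_eq_self (fun x => F (x, y * p.2)) p.1
        simp only [hswap, hinv]
    _ = ∫ p : G₁ × G₂, ∫ y, ∫ x, F (x, y * p.2) ∂μ ∂ν ∂ρ :=
        integral_integral_swap_of_hasCompactSupport
          (f := fun y (p : G₁ × G₂) => ∫ x, F (x, y * p.2) ∂μ) hcont (.of_compactSpace _)
    _ = ∫ _ : G₁ × G₂, ∫ y, ∫ x, F (x, y) ∂μ ∂ν ∂ρ := by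
        have hinv (p : G₁ × G₂) : ∫ y, ∫ x, F (x, y * p.2) ∂μ ∂ν = ∫ y, ∫ x, F (x, y) ∂μ ∂ν :=
          integral_mul_right_eq_self (fun y => ∫ x, F (x, y) ∂μ) p.2
        simp only [hinv]
    _ = ∫ y, ∫ x, F (x, y) ∂μ ∂ν := by simp

end Haar

noncomputable section Modulation

open scoped ENNReal

variable {α E : Type*} {_ : MeasurableSpace α} {μ : Measure α} [NormedAddCommGroup E]
  [NormedSpace ℂ E] {p : ℝ≥0∞}

theorem memLp_circle_smul {u : α → Circle} (hu : AEStronglyMeasurable u μ) {f : α → E}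
    (hf : MemLp f p μ) : MemLp (fun x => u x • f x) p μ :=
  hf.of_le (hu.smul hf.1) (.of_forall fun x => (Circle.norm_smul (u x) (f x)).le)

/-- Multiplication of `Lᵖ` functions by a measurable function with values in the circle. -/
def circleSMulLp {u : α → Circle} (hu : AEStronglyMeasurable u μ) : Lp E p μ →ₗ[ℂ] Lp E p μ where
  toFun f := (memLp_circle_smul hu (Lp.memLp f)).toLp _
  map_add' f g := by
    rw [← MemLp.toLp_add]
    refine (MemLp.toLp_eq_toLp_iff _ _).2 ?_
    filter_upwards [Lp.coeFn_add f g] with x hx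
    rw [hx, Pi.add_apply, smul_add, Pi.add_apply]
  map_smul' c f := by
    rw [RingHom.id_apply, ← MemLp.toLp_const_smul]
    refine (MemLp.toLp_eq_toLp_iff _ _).2 ?_
    filter_upwards [Lp.coeFn_smul c f] with x hx
    rw [hx, Pi.smul_apply, smul_comm, Pi.smul_apply]

theorem coeFn_circleSMulLp {u : α → Circle} (hu : AEStronglyMeasurable u μ) (f : Lp E p μ) :
    circleSMulLp hu f =ᵐ[μ] fun x => u x • f x :=
  (memLp_circle_smul hu (Lp.memLp f)).coeFn_toLp

theorem circleSMulLp_circleSMulLp {u v : α → Circle} (hu : AEStronglyMeasurable u μ)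
    (hv : AEStronglyMeasurable v μ) (huv : u * v = 1) (f : Lp E p μ) :
    circleSMulLp hu (circleSMulLp hv f) = f := by
  ext1
  filter_upwards [coeFn_circleSMulLp hu (circleSMulLp hv f), coeFn_circleSMulLp hv f]
    with x hx hx'
  rw [hx, hx', smul_smul, ← Pi.mul_apply, huv, Pi.one_apply, one_smul]

theorem norm_circleSMulLp {u : α → Circle} (hu : AEStronglyMeasurable u μ) (f : Lp E p μ) :
    ‖circleSMulLp hu f‖ = ‖f‖ := by
  refine congrArg ENNReal.toReal (eLpNorm_congr_norm_ae ?_)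
  filter_upwards [coeFn_circleSMulLp hu f] with x hx
  rw [hx, Circle.norm_smul]

/-- `circleSMulLp` as an isometric automorphism of `Lᵖ`. -/
def circleSMulLpₗᵢ [Fact (1 ≤ p)] {u : α → Circle} (hu : AEStronglyMeasurable u μ) :
    Lp E p μ ≃ₗᵢ[ℂ] Lp E p μ where
  toLinearEquiv := .ofLinearMap (circleSMulLp hu) (circleSMulLp hu.inv)
    (LinearMap.ext (circleSMulLp_circleSMulLp hu hu.inv (mul_inv_cancel u)))
    (LinearMap.ext (circleSMulLp_circleSMulLp hu.inv hu (inv_mul_cancel u)))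
  norm_map' := norm_circleSMulLp hu

theorem coeFn_circleSMulLpₗᵢ_symm [Fact (1 ≤ p)] {u : α → Circle} (hu : AEStronglyMeasurable u μ)
    (f : Lp E p μ) : (circleSMulLpₗᵢ (E := E) (p := p) hu).symm f =ᵐ[μ] fun x => (u x)⁻¹ • f x :=
  coeFn_circleSMulLp hu.inv f

end Modulation

noncomputable section Spectrum

theorem characterMap_dualProdEquiv_inv {G₁ G₂ : Type*} [CommGroup G₁] [TopologicalSpace G₁]
    [CommGroup G₂] [TopologicalSpace G₂] (γ : PontryaginDual G₁) (χ : PontryaginDual G₂) :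
    characterMap (dualProdEquiv G₁ G₂ (γ, χ))⁻¹ =
      (characterMap γ⁻¹).comp .fst * (characterMap χ⁻¹).comp .snd := by
  rw [← map_inv]
  exact ContinuousMap.ext fun p => Circle.coe_mul (γ⁻¹ p.1) (χ⁻¹ p.2)

variable {G : Type*} [CommGroup G] [TopologicalSpace G] [IsTopologicalGroup G] [CompactSpace G]

theorem mem_L1Spec_iff {Λ : Set (PontryaginDual G)} {f : L1 G} :
    f ∈ L1Spec Λ ↔ ∀ γ ∉ Λ, fourierCoeffL1 f γ = 0 :=
  ⟨fun hf _ hγ => not_not.1 fun h => hγ (hf h), fun hf γ hγ => not_not.1 fun h => hγ (hf γ h)⟩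

theorem fourierCoeffL1_eq_integralSMulL (f : L1 G) (γ : PontryaginDual G) :
    letI : MeasurableSpace G := borel G
    haveI : BorelSpace G := ⟨rfl⟩
    fourierCoeffL1 f γ = integralSMulL (haarProb G) (characterMap γ⁻¹) f := by
  let : MeasurableSpace G := borel G
  have : BorelSpace G := ⟨rfl⟩
  rw [integralSMulL_apply]
  refine integral_congr_ae (.of_forall fun x => ?_)
  exact congrArg (· * f x) (Circle.coe_inv_eq_conj (γ x)).symm

/-- Multiplication by a character, an isometric automorphism of `L¹(G)` that translates spectra. -/
def modulation (γ : PontryaginDual G) : L1 G ≃ₗᵢ[ℂ] L1 G :=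
  letI : MeasurableSpace G := borel G
  haveI : BorelSpace G := ⟨rfl⟩
  circleSMulLpₗᵢ (map_continuous γ).aestronglyMeasurable

theorem integral_modulation_symm (γ : PontryaginDual G) (f : L1 G) :
    letI : MeasurableSpace G := borel G
    ∫ x, (modulation γ).symm f x ∂(haarProb G) = fourierCoeffL1 f γ := by
  let : MeasurableSpace G := borel G
  have : BorelSpace G := ⟨rfl⟩
  refine integral_congr_ae ?_
  filter_upwards [coeFn_circleSMulLpₗᵢ_symm (map_continuous γ).aestronglyMeasurable f] with x hx
  exact hx.trans (congrArg (· * f x) (Circle.coe_inv_eq_conj (γ x)))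

variable {G₁ G₂ : Type*}
  [CommGroup G₁] [TopologicalSpace G₁] [IsTopologicalGroup G₁] [CompactSpace G₁] [T2Space G₁]
  [CommGroup G₂] [TopologicalSpace G₂] [IsTopologicalGroup G₂] [CompactSpace G₂] [T2Space G₂]

variable (G₁ G₂) in
theorem exists_slices_L1 : ∃ S : L1 (G₁ × G₂) →ₗᵢ[ℂ] @Lp G₂ (L1 G₁) (borel G₂) _ 1 (haarProb G₂),
    (∀ f, ∃ F, S F = @Lp.const G₂ (L1 G₁) (borel G₂) 1 (haarProb G₂) _ _ f) ∧
    ∀ Λ : Set (PontryaginDual G₁ × PontryaginDual G₂), ∀ F ∈ L1Spec (dualProdEquiv G₁ G₂ '' Λ),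
      ∀ᵐ y ∂(haarProb G₂), S F y ∈ L1Spec (Prod.fst '' Λ) := by
  let : MeasurableSpace G₁ := borel G₁
  have : BorelSpace G₁ := ⟨rfl⟩
  let : MeasurableSpace G₂ := borel G₂
  have : BorelSpace G₂ := ⟨rfl⟩
  let : MeasurableSpace (G₁ × G₂) := borel (G₁ × G₂)
  have : BorelSpace (G₁ × G₂) := ⟨rfl⟩
  have : (haarProb G₁).IsHaarMeasure := Measure.isHaarMeasure_haarMeasure _
  have : (haarProb G₂).IsHaarMeasure := Measure.isHaarMeasure_haarMeasure _
  have : (haarProb (G₁ × G₂)).IsHaarMeasure := Measure.isHaarMeasure_haarMeasure _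
  have : (haarProb G₁).Regular := Measure.regular_haarMeasure
  have : (haarProb G₂).Regular := Measure.regular_haarMeasure
  have : (haarProb (G₁ × G₂)).Regular := Measure.regular_haarMeasure
  have hprod := isProductIntegral_of_isHaarMeasure (haarProb G₁) (haarProb (G₁ × G₂)) (haarProb G₂)
  refine ⟨hprod.slices, fun f => ⟨_, hprod.slices_compMeasurePreserving
    (measurePreserving_fst_of_isHaarMeasure _ _) f⟩, fun Λ F hF => ?_⟩
  refine ae_mem_of_forall_integralSMulL_characterMap_mem fun χ => ?_
  refine mem_L1Spec_iff.2 fun γ hγ => ?_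
  have hmem : dualProdEquiv G₁ G₂ (γ, χ⁻¹) ∉ dualProdEquiv G₁ G₂ '' Λ := fun h =>
    hγ ⟨_, (dualProdEquiv G₁ G₂).injective.mem_set_image.1 h, rfl⟩
  rw [fourierCoeffL1_eq_integralSMulL, hprod.integralSMulL_slices, ← inv_inv χ,
    ← characterMap_dualProdEquiv_inv, ← fourierCoeffL1_eq_integralSMulL]
  exact mem_L1Spec_iff.1 hF _ hmem

end Spectrum

section Rich

theorem HasPeaks.isRich {α 𝕜 : Type*} {_ : MeasurableSpace α} {μ : Measure α} [RCLike 𝕜]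
    [IsFiniteMeasure μ] {N : Submodule 𝕜 (Lp 𝕜 1 μ)} [IsClosed (N : Set (Lp 𝕜 1 μ))]
    {e : Lp 𝕜 1 μ ≃ₗᵢ[𝕜] Lp 𝕜 1 μ}
    (h : HasPeaks (N.mkQL ∘L (e : Lp 𝕜 1 μ →L[𝕜] Lp 𝕜 1 μ))) : IsRich N :=
  isNarrow_of_isReplaceable fun φ ε hε y => by
    simpa using IsReplaceable.map_linearIsometryEquiv (T := N.mkQL) (φ := φ) e
      (h.isReplaceable hε (e.symm y))

variable {G : Type*} [CommGroup G] [TopologicalSpace G] [IsTopologicalGroup G] [CompactSpace G]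

theorem isRich_L1Spec_univ [T1Space G] [Infinite G] :
    IsRich (L1Spec (Set.univ : Set (PontryaginDual G))) := by
  let : MeasurableSpace G := borel G
  have : BorelSpace G := ⟨rfl⟩
  have : (haarProb G).IsHaarMeasure := Measure.isHaarMeasure_haarMeasure _
  have : (haarProb G).Regular := Measure.regular_haarMeasure
  have := nullSingletonClass_of_infinite (haarProb G)
  have hzero : (L1Spec (Set.univ : Set (PontryaginDual G))).mkQL = 0 :=
    ContinuousLinearMap.ext fun f => (Submodule.Quotient.mk_eq_zero _).2
      (mem_L1Spec_iff.2 fun γ hγ => absurd (Set.mem_univ γ) hγ)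
  refine HasPeaks.isRich (e := .refl ℂ (L1 G)) ?_
  rw [hzero, ContinuousLinearMap.zero_comp]
  exact hasPeaks_zero

theorem not_hasPeaks_of_finite {E : Type*} [NormedAddCommGroup E] [NormedSpace ℂ E] [T1Space G]
    [Finite G] (T : L1 G →L[ℂ] E) : ¬ HasPeaks T := by
  let : MeasurableSpace G := borel G
  have : BorelSpace G := ⟨rfl⟩
  have : (haarProb G).IsHaarMeasure := Measure.isHaarMeasure_haarMeasure _
  have hpos := (isOpen_discrete {(1 : G)}).measure_pos (haarProb G) (Set.singleton_nonempty _)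
  exact not_hasPeaks_of_measure_singleton_ne_zero hpos.ne' T

end Rich

theorem mainTheorem12
    {G₁ G₂ : Type*}
    [CommGroup G₁] [TopologicalSpace G₁] [IsTopologicalGroup G₁] [CompactSpace G₁] [T2Space G₁]
    [CommGroup G₂] [TopologicalSpace G₂] [IsTopologicalGroup G₂] [CompactSpace G₂] [T2Space G₂]
    (Λ : Set (PontryaginDual G₁ × PontryaginDual G₂))
    (hΛ : IsRich (L1Spec (G := G₁ × G₂) (dualProdEquiv G₁ G₂ '' Λ))) :
    (Infinite G₁ → IsRich (L1Spec (G := G₁) (Prod.fst '' Λ))) ∧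
      (Finite G₁ → Prod.fst '' Λ = Set.univ) := by
  obtain ⟨S, hconst, hslices⟩ := exists_slices_L1 G₁ G₂
  have hpeaks (γ : PontryaginDual G₁) (hγ : γ ∉ Prod.fst '' Λ) :
      HasPeaks ((L1Spec (Prod.fst '' Λ)).mkQL ∘L (modulation γ : L1 G₁ →L[ℂ] L1 G₁)) :=
    hΛ.hasPeaks S hconst (hslices Λ) (modulation γ) fun f hf =>
      (integral_modulation_symm γ f).trans (mem_L1Spec_iff.1 hf γ hγ)
  refine ⟨fun _ => ?_, fun _ => Set.eq_univ_of_forall fun γ => ?_⟩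
  · by_cases huniv : Prod.fst '' Λ = Set.univ
    · rw [huniv]
      exact isRich_L1Spec_univ
    · obtain ⟨γ, hγ⟩ := (Set.ne_univ_iff_exists_notMem _).1 huniv
      exact (hpeaks γ hγ).isRich
  · by_contra hγ
    exact not_hasPeaks_of_finite _ (hpeaks γ hγ)
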